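/- Let $(\mathcal V,\underline{\mathcal V}(-,-),\mathbb 1,i,j,L,V)$ be a closed category in the sense of Eilenberg and Kelly, i.e. a category $\mathcal V$ with a functor $\underline{\mathcal V}(-,-):\mathcal V^{op}\times\mathcal V\to\mathcal V$, an object $\mathbb 1$, a natural isomorphism $i_X:X\to\underline{\mathcal V}(\mathbb 1,X)$, a transformation $j_X:\mathbb 1\to\underline{\mathcal V}(X,X)$ dinatural in $X$, a transformation $L^X_{YZ}:\underline{\mathcal V}(Y,Z)\to\underline{\mathcal V}(\underline{\mathcal V}(X,Y),\underline{\mathcal V}(X,Z))$ natural in $Y,Z$ and dinatural in $X$, and a functor $V:\mathcal V\to\mathbf{Set}$, such that * (CC0) $V\underline{\mathcal V}(-,-)=\mathcal V(-,-)$; * (CC1) $L^X_{YY}\circ j_Y=j_{\underline{\mathcal V}(X,Y)}$; * (CC2) $\underline{\mathcal V}(j_X,1)\circ L^X_{XY}=i_{\underline{\mathcal V}(X,Y)}$; * (CC3) $\underline{\mathcal V}(1,L^X_{YW})\circ L^Y_{UW}=\underline{\mathcal V}(L^X_{YU},1)\circ L^{\underline{\mathcal V}(X,Y)}_{\underline{\mathcal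 V}(X,U),\underline{\mathcal V}(X,W)}\circ L^X_{UW}$; * (CC4) $\underline{\mathcal V}(i_Y,1)\circ L^{\mathbb 1}_{YZ}=\underline{\mathcal V}(1,i_Z)$; * (CC5') the map $V(i_{\underline{\mathcal V}(X,X)}):\mathcal V(X,X)\to\mathcal V(\mathbb 1,\underline{\mathcal V}(X,X))$ sends $1_X$ to $j_X$. Let $\underline{\mathcal V}$ also denote the $\mathcal V$-category with the objects of $\mathcal V$, $\mathrm{Hom}$-objects $\underline{\mathcal V}(X,Y)$ and structure morphisms $j,L$, and let $L^X:\underline{\mathcal V}\to\underline{\mathcal V}$ be the $\mathcal V$-functor $Y\mapsto\underline{\mathcal V}(X,Y)$ acting on $\mathrm{Hom}$-objects by $L^X_{YZ}$. Let $\mathsf V$ be the multicategory with the objects of $\mathcal V$, in which a morphism $X_1,\dots,X_n\to Y$ ($n\ge 0$) is a $\mathcal V$-natural transformation $L^Y\to L^{X_n}\circ\dots\circ L^{X_1}$ (to $\mathrm{Id}$ if $n=0$), identities are identity transformations, and the composite of $f_1,\dots,f_n$ with $g:Y_1,\dots,Y_n\to Z$ is $g:L^Z\to L^{Y_n}\circ\dots\circ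 L^{Y_1}$ followed by the horizontal composite of $f_n,\dots,f_1$. Then: 1. $\mathsf V$ is closed: for all objects $X_1,\dots,X_m,Z$ ($m\ge 0$) there are an object $H$ and a morphism $\mathrm{ev}:X_1,\dots,X_m,H\to Z$ such that for all $Y_1,\dots,Y_n$ ($n\ge 0$) the map $\mathsf V(Y_1,\dots,Y_n;H)\to\mathsf V(X_1,\dots,X_m,Y_1,\dots,Y_n;Z)$, $f\mapsto\mathrm{ev}\circ(1_{X_1},\dots,1_{X_m},f)$, is bijective. 2. For any choice of such internal $\mathrm{Hom}$-objects and evaluations, $\mathbb 1$ is a unit object of $\mathsf V$: there is $u:()\to\mathbb 1$ such that for each object $X$ the morphism $[u,1]=\mathrm{ev}\circ(u,1):[\mathbb 1,X]\to X$ is an isomorphism, where $[X,Z]$ denotes the chosen internal $\mathrm{Hom}$-object $H$ for $m=1$. 3. For any such choice and any unit object $(I,u)$ of $\mathsf V$ (an object $I$ with $u:()\to I$ such that all $\mathrm{ev}\circ(u,1):[I,X]\to X$ are isomorphisms), the underlying closed category of $\mathsf V$ is isomorphic to $\mathcal V$ as a closed category, i.e. by an invertible closed functor. Here the underlying closed category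 has as morphisms $X\to Y$ those of $\mathsf V(X;Y)$, internal $\mathrm{Hom}$-functor $[-,-]$ and unit $I$; its $i_X$ is $[u,1]^{-1}$; its $j_X:I\to[X,X]$ is the unique morphism such that $j_X\circ u:()\to[X,X]$ is the morphism corresponding to $1_X$ under the bijection in (1); and its $L^X_{YZ}$ is determined by $\mathrm{ev}\circ(1,L^X_{YZ})=\mu$, where $\mu:[X,Y],[Y,Z]\to[X,Z]$ is determined by $\mathrm{ev}\circ(1_X,\mu)=\mathrm{ev}\circ(\mathrm{ev},1)$. -/

import Mathlib

open CategoryTheory Opposite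

universe v u v₁ u₁ v₂ u₂ v₃ u₃ w w₁ w₂ w₃

set_option linter.checkUnivs false

/-! ## Closed categories -/

/-- A category with an internal `Hom`-functor `Cᵒᵖ × C → C` (in curried form) and a
distinguished object. -/
structure HomCategory where
  carrier : Type u
  [cat : Category.{v} carrier]
  ihom : carrierᵒᵖ ⥤ carrier ⥤ carrier
  unit : carrier

namespace HomCategory

attribute [instance] HomCategory.cat

variable (C : HomCategory.{v, u})

/-- The internal `Hom`-object `[X, Y]`. -/
abbrev H (X Y : C.carrier) : C.carrier := (C.ihom.obj (op X)).obj Y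

/-- The morphism `[f, 1] : [X', Y] ⟶ [X, Y]`. -/
abbrev pre {X X' : C.carrier} (f : X ⟶ X') (Y : C.carrier) : C.H X' Y ⟶ C.H X Y :=
  (C.ihom.map f.op).app Y

/-- The morphism `[1, g] : [X, Y] ⟶ [X, Y']`. -/
abbrev post (X : C.carrier) {Y Y' : C.carrier} (g : Y ⟶ Y') : C.H X Y ⟶ C.H X Y' :=
  (C.ihom.obj (op X)).map g

end HomCategory

/-- The data of a closed category subject to the axioms CC1--CC4, which are common to the
definition of Eilenberg and Kelly and to that of Street and Laplaza. -/
structure PreClosedCategory extends HomCategory.{v, u} where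
  /-- the natural isomorphism `i : Id ≅ [1, -]` -/
  i : 𝟭 carrier ≅ ihom.obj (op unit)
  j : ∀ X : carrier, unit ⟶ toHomCategory.H X X
  L : ∀ X Y Z : carrier, toHomCategory.H Y Z ⟶
    toHomCategory.H (toHomCategory.H X Y) (toHomCategory.H X Z)
  /-- `j` is dinatural -/
  j_dinatural : ∀ {X Y : carrier} (f : X ⟶ Y),
    j X ≫ toHomCategory.post X f = j Y ≫ toHomCategory.pre f Y
  /-- `L X Y Z` is natural in `Y` and in `Z` -/
  L_natural_left : ∀ (X : carrier) {Y Y' : carrier} (g : Y ⟶ Y') (Z : carrier),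
    toHomCategory.pre g Z ≫ L X Y Z =
      L X Y' Z ≫ toHomCategory.pre (toHomCategory.post X g) (toHomCategory.H X Z)
  L_natural_right : ∀ (X Y : carrier) {Z Z' : carrier} (h : Z ⟶ Z'),
    toHomCategory.post Y h ≫ L X Y Z' =
      L X Y Z ≫ toHomCategory.post (toHomCategory.H X Y) (toHomCategory.post X h)
  /-- `L X Y Z` is dinatural in `X` -/
  L_dinatural : ∀ {X X' : carrier} (f : X ⟶ X') (Y Z : carrier),
    L X' Y Z ≫ toHomCategory.post (toHomCategory.H X' Y) (toHomCategory.pre f Z) =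
      L X Y Z ≫ toHomCategory.pre (toHomCategory.pre f Y) (toHomCategory.H X Z)
  CC1 : ∀ X Y : carrier, j Y ≫ L X Y Y = j (toHomCategory.H X Y)
  CC2 : ∀ X Y : carrier,
    L X X Y ≫ toHomCategory.pre (j X) (toHomCategory.H X Y) = i.hom.app (toHomCategory.H X Y)
  CC3 : ∀ X Y U V : carrier,
    L Y U V ≫ toHomCategory.post (toHomCategory.H Y U) (L X Y V) =
      L X U V ≫ L (toHomCategory.H X Y) (toHomCategory.H X U) (toHomCategory.H X V) ≫
        toHomCategory.pre (L X Y U)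
          (toHomCategory.H (toHomCategory.H X Y) (toHomCategory.H X V))
  CC4 : ∀ Y Z : carrier,
    L unit Y Z ≫ toHomCategory.pre (i.hom.app Y) (toHomCategory.H unit Z) =
      toHomCategory.post Y (i.hom.app Z)

/-- The map `γ : C(X, Y) → C(1, [X, Y])`, `f ↦ j_X · [1, f]`. -/
def PreClosedCategory.γ (C : PreClosedCategory.{v, u}) {X Y : C.carrier} (f : X ⟶ Y) :
    C.unit ⟶ C.H X Y :=
  C.j X ≫ C.post X f

/-- Closed categories in the sense of Street and Laplaza: axioms CC1--CC5. -/
structure ClosedCategory extends PreClosedCategory.{v, u} where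
  CC5 : ∀ X Y : carrier,
    Function.Bijective (fun f : X ⟶ Y => toPreClosedCategory.γ f)

/-- The data of a closed category together with a functor `V : C ⥤ Set` satisfying
the axiom CC0, that is, `V ∘ [-, -] = C(-, -)`. -/
structure PreEKClosedCategory extends PreClosedCategory.{v, u} where
  V : carrier ⥤ Type v
  CC0 : ihom ⋙ (Functor.whiskeringRight carrier carrier (Type v)).obj V = coyoneda

theorem PreEKClosedCategory.V_obj (C : PreEKClosedCategory.{v, u}) (X Y : C.carrier) :
    C.V.obj (C.H X Y) = (X ⟶ Y) :=
  Functor.congr_obj (Functor.congr_obj C.CC0 (op X)) Y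

/-- A morphism `X ⟶ Y` viewed as an element of the set `V[X, Y] = C(X, Y)`. -/
def PreEKClosedCategory.elt (C : PreEKClosedCategory.{v, u}) {X Y : C.carrier} (f : X ⟶ Y) :
    C.V.obj (C.H X Y) :=
  cast (C.V_obj X Y).symm f

/-- Closed categories in the sense of Eilenberg and Kelly: axioms CC0--CC4 and the axiom CC5',
saying that `V i_{[X, X]} : C(X, X) = V[X, X] → V[1, [X, X]] = C(1, [X, X])` sends `1_X`
to `j_X`. -/
structure EKClosedCategory extends PreEKClosedCategory.{v, u} where
  CC5' : ∀ X : carrier,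
    V.map (i.hom.app (toHomCategory.H X X)) (toPreEKClosedCategory.elt (𝟙 X)) =
      toPreEKClosedCategory.elt (j X)

theorem PreEKClosedCategory.V_map_post (C : PreEKClosedCategory.{v, u}) {X Y Z : C.carrier}
    (f : X ⟶ Y) (g : Y ⟶ Z) : C.V.map (C.post X g) (C.elt f) = C.elt (f ≫ g) := by
  have key : ∀ (F : C.carrierᵒᵖ ⥤ C.carrier ⥤ Type v) (h : F = coyoneda)
      (e : ∀ A B, (F.obj (op A)).obj B = (A ⟶ B)),
      (F.obj (op X)).map g (cast (e X Y).symm f) = cast (e X Z).symm (f ≫ g) := by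
    intro F h e
    subst h
    rfl
  exact key _ C.CC0 (fun A B => C.V_obj A B)

theorem EKClosedCategory.γ_eq (C : EKClosedCategory.{v, u}) {X Y : C.carrier} (f : X ⟶ Y) :
    C.V.map (C.i.hom.app (C.H X Y)) (C.elt f) = C.elt (C.γ f) := by
  have nat := C.i.hom.naturality (C.post X f)
  have h1 : C.V.map (C.post X f ≫ C.i.hom.app (C.H X Y)) (C.elt (𝟙 X)) =
      C.V.map (C.i.hom.app (C.H X X) ≫ C.post C.unit (C.post X f)) (C.elt (𝟙 X)) :=
    congrArg (fun t => C.V.map t (C.elt (𝟙 X))) nat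
  rw [Functor.map_comp, Functor.map_comp, types_comp_apply, types_comp_apply, C.CC5',
    C.V_map_post, C.V_map_post, Category.id_comp] at h1
  exact h1

/-- A closed category in the sense of Eilenberg and Kelly is a closed category. -/
def EKClosedCategory.toClosedCategory (C : EKClosedCategory.{v, u}) :
    ClosedCategory.{v, u} where
  toPreClosedCategory := C.toPreClosedCategory
  CC5 X Y := by
    have hV : Function.Bijective
        (fun t : C.V.obj (C.H X Y) => C.V.map (C.i.hom.app (C.H X Y)) t) :=
      (isIso_iff_bijective (C.V.map (C.i.hom.app (C.H X Y)))).mp inferInstance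
    have he : ∀ A B : C.carrier, Function.Bijective (fun f : A ⟶ B => C.elt f) :=
      fun A B => (Equiv.cast (C.V_obj A B).symm).bijective
    have hc : Function.Bijective
        ((fun f : C.unit ⟶ C.H X Y => C.elt f) ∘ fun f : X ⟶ Y => C.γ f) := by
      have heq : ((fun f : C.unit ⟶ C.H X Y => C.elt f) ∘ fun f : X ⟶ Y => C.γ f) =
          (fun t : C.V.obj (C.H X Y) => C.V.map (C.i.hom.app (C.H X Y)) t) ∘
            fun f : X ⟶ Y => C.elt f := by
        funext f
        exact (C.γ_eq f).symm
      rw [heq]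
      exact hV.comp (he X Y)
    exact (Function.Bijective.of_comp_iff' (he _ _) _).mp hc

/-! ## Closed functors and isomorphisms of closed categories -/

/-- Closed functors `(φ, φ̂, φ⁰)`. -/
structure ClosedFunctor (C : ClosedCategory.{v₁, u₁}) (D : ClosedCategory.{v₂, u₂}) where
  φ : C.carrier ⥤ D.carrier
  φhat : ∀ X Y : C.carrier, φ.obj (C.H X Y) ⟶ D.H (φ.obj X) (φ.obj Y)
  φ0 : D.unit ⟶ φ.obj C.unit
  φhat_natural_left : ∀ {X X' : C.carrier} (f : X ⟶ X') (Y : C.carrier),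
    φ.map (C.pre f Y) ≫ φhat X Y = φhat X' Y ≫ D.pre (φ.map f) (φ.obj Y)
  φhat_natural_right : ∀ (X : C.carrier) {Y Y' : C.carrier} (g : Y ⟶ Y'),
    φ.map (C.post X g) ≫ φhat X Y' = φhat X Y ≫ D.post (φ.obj X) (φ.map g)
  CF1 : ∀ X : C.carrier, φ0 ≫ φ.map (C.j X) ≫ φhat X X = D.j (φ.obj X)
  CF2 : ∀ X : C.carrier,
    φ.map (C.i.hom.app X) ≫ φhat C.unit X ≫ D.pre φ0 (φ.obj X) = D.i.hom.app (φ.obj X)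
  CF3 : ∀ X Y Z : C.carrier,
    φ.map (C.L X Y Z) ≫ φhat (C.H X Y) (C.H X Z) ≫
        D.post (φ.obj (C.H X Y)) (φhat X Z) =
      φhat Y Z ≫ D.L (φ.obj X) (φ.obj Y) (φ.obj Z) ≫
        D.pre (φhat X Y) (D.H (φ.obj X) (φ.obj Z))

namespace HomCategory

variable (C : HomCategory.{v, u})

theorem pre_id (X Y : C.carrier) : C.pre (𝟙 X) Y = 𝟙 (C.H X Y) := by
  dsimp only [pre]; simp

theorem pre_comp {X Y Z : C.carrier} (f : X ⟶ Y) (g : Y ⟶ Z) (W : C.carrier) :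
    C.pre (f ≫ g) W = C.pre g W ≫ C.pre f W := by
  dsimp only [pre]; simp

theorem post_id (X Y : C.carrier) : C.post X (𝟙 Y) = 𝟙 (C.H X Y) := by simp

theorem post_comp (W : C.carrier) {X Y Z : C.carrier} (f : X ⟶ Y) (g : Y ⟶ Z) :
    C.post W (f ≫ g) = C.post W f ≫ C.post W g := by simp

theorem pre_post {X X' Y Y' : C.carrier} (f : X ⟶ X') (g : Y ⟶ Y') :
    C.pre f Y ≫ C.post X g = C.post X' g ≫ C.pre f Y' :=
  ((C.ihom.map f.op).naturality g).symm

end HomCategory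

namespace ClosedFunctor

/-- The identity closed functor. -/
def id (C : ClosedCategory.{v₁, u₁}) : ClosedFunctor C C where
  φ := 𝟭 C.carrier
  φhat X Y := 𝟙 (C.H X Y)
  φ0 := 𝟙 C.unit
  φhat_natural_left f Y := by simp
  φhat_natural_right X Y Y' g := by simp
  CF1 X := by simp
  CF2 X := by simp [HomCategory.pre_id]
  CF3 X Y Z := by simp [HomCategory.pre_id]

variable {C : ClosedCategory.{v₁, u₁}} {D : ClosedCategory.{v₂, u₂}}
  {E : ClosedCategory.{v₃, u₃}}

/-- Composition of closed functors. -/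
def comp (Φ : ClosedFunctor C D) (Ψ : ClosedFunctor D E) : ClosedFunctor C E where
  φ := Φ.φ ⋙ Ψ.φ
  φhat X Y := Ψ.φ.map (Φ.φhat X Y) ≫ Ψ.φhat (Φ.φ.obj X) (Φ.φ.obj Y)
  φ0 := Ψ.φ0 ≫ Ψ.φ.map Φ.φ0
  φhat_natural_left f Y := by
    simp only [Functor.comp_map, Functor.comp_obj]
    rw [← Category.assoc, ← Functor.map_comp, Φ.φhat_natural_left, Functor.map_comp,
      Category.assoc, Ψ.φhat_natural_left, Category.assoc]
  φhat_natural_right X Y Y' g := by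
    simp only [Functor.comp_map, Functor.comp_obj]
    rw [← Category.assoc, ← Functor.map_comp, Φ.φhat_natural_right, Functor.map_comp,
      Category.assoc, Ψ.φhat_natural_right, Category.assoc]
  CF1 X := by
    simp only [Functor.comp_map, Functor.comp_obj]
    rw [← Ψ.CF1, ← Φ.CF1 X]
    simp only [Functor.map_comp, Category.assoc]
  CF2 X := by
    simp only [Functor.comp_map, Functor.comp_obj]
    rw [← Ψ.CF2, ← Φ.CF2 X, E.pre_comp]
    simp only [Functor.map_comp, Category.assoc]
    rw [reassoc_of% (Ψ.φhat_natural_left Φ.φ0 (Φ.φ.obj X))]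
  CF3 X Y Z := by
    simp only [Functor.comp_map, Functor.comp_obj]
    have h1 := congrArg (fun t => Ψ.φ.map t) (Φ.CF3 X Y Z)
    simp only [Functor.map_comp] at h1
    have h2 := Ψ.CF3 (Φ.φ.obj X) (Φ.φ.obj Y) (Φ.φ.obj Z)
    rw [E.post_comp, E.pre_comp]
    simp only [Category.assoc]
    rw [← reassoc_of% h2, ← reassoc_of% (Ψ.φhat_natural_right _ (Φ.φhat X Z)),
      reassoc_of% h1, ← E.pre_post, reassoc_of% (Ψ.φhat_natural_left (Φ.φhat X Y))]

end ClosedFunctor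

/-- Isomorphisms of closed categories: invertible closed functors. -/
structure ClosedCategory.Iso (C : ClosedCategory.{v₁, u₁}) (D : ClosedCategory.{v₂, u₂}) where
  hom : ClosedFunctor C D
  inv : ClosedFunctor D C
  hom_inv_id : hom.comp inv = ClosedFunctor.id C
  inv_hom_id : inv.comp hom = ClosedFunctor.id D

/-! ## Categories enriched in a closed category -/

/-- Categories enriched in a closed category. -/
structure VCategory (C : ClosedCategory.{v, u}) where
  Obj : Type w
  hom : Obj → Obj → C.carrier
  j : ∀ X, C.unit ⟶ hom X X
  L : ∀ X Y Z, hom Y Z ⟶ C.H (hom X Y) (hom X Z)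
  VC1 : ∀ X Y, j Y ≫ L X Y Y = C.j (hom X Y)
  VC2 : ∀ X Y, L X X Y ≫ C.pre (j X) (hom X Y) = C.i.hom.app (hom X Y)
  VC3 : ∀ X Y U W,
    L Y U W ≫ C.post (hom Y U) (L X Y W) =
      L X U W ≫ C.L (hom X Y) (hom X U) (hom X W) ≫
        C.pre (L X Y U) (C.H (hom X Y) (hom X W))

/-- The closed category `C` as a category enriched in itself. -/
@[reducible]
def ClosedCategory.und (C : ClosedCategory.{v, u}) : VCategory.{v, u, u} C where
  Obj := C.carrier
  hom X Y := C.H X Y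
  j := C.j
  L := C.L
  VC1 := C.CC1
  VC2 := C.CC2
  VC3 := C.CC3

/-- Functors enriched in a closed category. -/
@[ext]
structure VFunctor {C : ClosedCategory.{v, u}} (A : VCategory.{v, u, w₁} C)
    (B : VCategory.{v, u, w₂} C) where
  obj : A.Obj → B.Obj
  map : ∀ X Y, A.hom X Y ⟶ B.hom (obj X) (obj Y)
  VF1 : ∀ X, A.j X ≫ map X X = B.j (obj X)
  VF2 : ∀ X Y Z,
    A.L X Y Z ≫ C.post (A.hom X Y) (map X Z) =
      map Y Z ≫ B.L (obj X) (obj Y) (obj Z) ≫ C.pre (map X Y) (B.hom (obj X) (obj Z))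

namespace VFunctor

variable {C : ClosedCategory.{v, u}}

/-- The identity enriched functor. -/
@[reducible]
def id (A : VCategory.{v, u, w} C) : VFunctor A A where
  obj X := X
  map X Y := 𝟙 (A.hom X Y)
  VF1 X := by simp
  VF2 X Y Z := by simp [HomCategory.pre_id]

/-- The composite of enriched functors: first `F`, then `G`. -/
@[reducible]
def comp {A : VCategory.{v, u, w₁} C} {B : VCategory.{v, u, w₂} C}
    {D : VCategory.{v, u, w₃} C} (F : VFunctor A B) (G : VFunctor B D) : VFunctor A D where
  obj X := G.obj (F.obj X)
  map X Y := F.map X Y ≫ G.map (F.obj X) (F.obj Y)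
  VF1 X := by rw [← Category.assoc, F.VF1, G.VF1]
  VF2 X Y Z := by
    rw [C.post_comp, C.pre_comp, reassoc_of% (F.VF2 X Y Z), C.pre_post,
      reassoc_of% (G.VF2 (F.obj X) (F.obj Y) (F.obj Z)), Category.assoc]

/-- The enriched functor `L^X : A → C`, `Y ↦ A(X, Y)`. -/
@[reducible]
def L (A : VCategory.{v, u, w} C) (X : A.Obj) : VFunctor A C.und where
  obj Y := A.hom X Y
  map Y Z := A.L X Y Z
  VF1 Y := A.VC1 X Y
  VF2 Y Z W := A.VC3 X Y Z W

/-- The morphism `G₀ f : G X ⟶ G Y` obtained by applying an enriched functor `G : C → C` to a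
morphism `f : X ⟶ Y` of `C`; it is characterized by `γ (G₀ f) = γ f · G_{X, Y}`. -/
noncomputable def map₀ (G : VFunctor C.und C.und) {X Y : C.carrier} (f : X ⟶ Y) :
    (G.obj X : C.carrier) ⟶ G.obj Y :=
  ((C.CC5 (G.obj X) (G.obj Y)).2 (C.γ f ≫ G.map X Y)).choose

theorem γ_map₀ (G : VFunctor C.und C.und) {X Y : C.carrier} (f : X ⟶ Y) :
    C.γ (G.map₀ f) = C.γ f ≫ G.map X Y :=
  ((C.CC5 (G.obj X) (G.obj Y)).2 (C.γ f ≫ G.map X Y)).choose_spec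

end VFunctor

/-- Enriched natural transformations between enriched functors `A → C`. -/
@[ext]
structure VNatTrans {C : ClosedCategory.{v, u}} {A : VCategory.{v, u, w} C}
    (F G : VFunctor A C.und) where
  app : ∀ X, (F.obj X : C.carrier) ⟶ G.obj X
  naturality : ∀ X Y,
    F.map X Y ≫ C.post (F.obj X) (app Y) = G.map X Y ≫ C.pre (app X) (G.obj Y)

namespace ClosedCategory

variable (C : ClosedCategory.{v, u})

theorem γ_injective {X Y : C.carrier} {f g : X ⟶ Y} (h : C.γ f = C.γ g) : f = g :=
  (C.CC5 X Y).1 h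

theorem γ_id (X : C.carrier) : C.γ (𝟙 X) = C.j X := by
  simp [PreClosedCategory.γ]

theorem γ_post {X Y Z : C.carrier} (f : X ⟶ Y) (g : Y ⟶ Z) :
    C.γ f ≫ C.post X g = C.γ (f ≫ g) := by
  simp [PreClosedCategory.γ]

theorem γ_pre {X Y Z : C.carrier} (f : X ⟶ Y) (g : Y ⟶ Z) :
    C.γ g ≫ C.pre f Z = C.γ (f ≫ g) := by
  rw [← γ_post]
  unfold PreClosedCategory.γ
  rw [Category.assoc, ← C.pre_post, ← reassoc_of% (C.j_dinatural f), Category.assoc]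

theorem γ_L (X : C.carrier) {Y Z : C.carrier} (f : Y ⟶ Z) :
    C.γ f ≫ C.L X Y Z = C.γ (C.post X f) := by
  unfold PreClosedCategory.γ
  rw [Category.assoc, C.L_natural_right, reassoc_of% (C.CC1 X Y)]

theorem L_pre_γ {X Y : C.carrier} (f : X ⟶ Y) (Z : C.carrier) :
    C.L X Y Z ≫ C.pre (C.γ f) (C.H X Z) = C.pre f Z ≫ C.i.hom.app (C.H X Z) := by
  unfold PreClosedCategory.γ
  rw [C.pre_comp, ← reassoc_of% (C.L_natural_left X f Z), C.CC2]

end ClosedCategory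

namespace VFunctor

variable {C : ClosedCategory.{v, u}} (G : VFunctor C.und C.und)

theorem post_map {X Y Z : C.carrier} (g : Y ⟶ Z) :
    C.post X g ≫ G.map X Z = G.map X Y ≫ C.post (G.obj X) (G.map₀ g) := by
  apply C.γ_injective
  have h := congrArg (fun t => C.γ g ≫ t) (G.VF2 X Y Z)
  simp only [] at h
  rw [reassoc_of% (C.γ_L X g), C.γ_post, ← Category.assoc, ← G.γ_map₀, reassoc_of% (C.γ_L (G.obj X) (G.map₀ g)), C.γ_pre] at h
  exact h

theorem pre_map {X Y Z : C.carrier} (f : X ⟶ Y) :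
    C.pre f Z ≫ G.map X Z = G.map Y Z ≫ C.pre (G.map₀ f) (G.obj Z) := by
  have h := congrArg (fun t => t ≫ C.pre (C.γ f) (C.H (G.obj X) (G.obj Z))) (G.VF2 X Y Z)
  simp only [Category.assoc] at h
  rw [← C.pre_post, ← C.pre_comp, ← G.γ_map₀, reassoc_of% (C.L_pre_γ f Z), C.L_pre_γ (G.map₀ f)] at h
  have h2 := C.i.hom.naturality (G.map X Z)
  simp only [Functor.id_obj, Functor.id_map] at h2
  rw [← h2] at h
  exact (cancel_mono (C.i.hom.app (C.H (G.obj X) (G.obj Z)))).mp (by simpa using h)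

end VFunctor

/-! ## Multicategories -/

/-- `Fam R [a₁, …, aₙ] [b₁, …, bₙ]` is the type of families of elements of
`R a₁ b₁, …, R aₙ bₙ`. -/
inductive Fam {α : Type u₁} {β : Type u₂} (R : α → β → Type w) :
    List α → List β → Type (max u₁ u₂ w) where
  | nil : Fam R [] []
  | cons {a : α} {b : β} {as : List α} {bs : List β} :
      R a b → Fam R as bs → Fam R (a :: as) (b :: bs)

namespace Fam

variable {α : Type u₁} {β : Type u₂} {R : α → β → Type w}

/-- Concatenation of families. -/
def append : {as : List α} → {bs : List β} → {as' : List α} → {bs' : List β} →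
    Fam R as bs → Fam R as' bs' → Fam R (as ++ as') (bs ++ bs')
  | _, _, _, _, nil, gs => gs
  | _, _, _, _, cons f fs, gs => cons f (append fs gs)

/-- Concatenation of a family of families. -/
def flatten : {as : List (List α)} → {bs : List (List β)} →
    Fam (Fam R) as bs → Fam R as.flatten bs.flatten
  | _, _, nil => nil
  | _, _, cons F Fs => append F (flatten Fs)

end Fam

/-- Multigraphs. -/
structure Multigraph where
  Obj : Type u
  Hom : List Obj → Obj → Type v

/-- Multigraphs with identities and with a composition operation
`(f₁, …, fₙ), g ↦ (f₁, …, fₙ) · g`. -/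
structure PreMulticategory extends Multigraph.{v, u} where
  id : ∀ X : Obj, Hom [X] X
  comp : ∀ {Xs : List (List Obj)} {Ys : List Obj} {Z : Obj},
    Fam Hom Xs Ys → Hom Ys Z → Hom Xs.flatten Z

namespace PreMulticategory

variable (M : PreMulticategory.{v, u})

/-- The family `(1, …, 1, f₁, …, fₙ)`. -/
def idsAppend : (Xs : List M.Obj) → {As : List (List M.Obj)} → {Bs : List M.Obj} →
    Fam M.Hom As Bs → Fam M.Hom (Xs.map (fun X => [X]) ++ As) (Xs ++ Bs)
  | [], _, _, fs => fs
  | X :: Xs, _, _, fs => Fam.cons (M.id X) (idsAppend Xs fs)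

/-- The family of identities `(1, …, 1)`. -/
def ids : (Xs : List M.Obj) → Fam M.Hom (Xs.map (fun X => [X])) Xs
  | [] => Fam.nil
  | X :: Xs => Fam.cons (M.id X) (ids Xs)

/-- Given families `Fᵢ = (fᵢ₁, …)` and morphisms `gᵢ`, the family of composites `Fᵢ · gᵢ`. -/
def compEach : {Xs : List (List (List M.Obj))} → {Ys : List (List M.Obj)} →
    {Zs : List M.Obj} → Fam (Fam M.Hom) Xs Ys → Fam M.Hom Ys Zs →
    Fam M.Hom (Xs.map List.flatten) Zs
  | _, _, _, Fam.nil, Fam.nil => Fam.nil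
  | _, _, _, Fam.cons F Fs, Fam.cons g gs => Fam.cons (M.comp F g) (compEach Fs gs)

end PreMulticategory

/-- Multicategories. In each axiom the sources of the two sides are equal lists, but not by
definition, whence the use of heterogeneous equality. -/
structure Multicategory extends PreMulticategory.{v, u} where
  id_comp : ∀ {Ys : List Obj} {Z : Obj} (g : Hom Ys Z),
    HEq (comp (toPreMulticategory.ids Ys) g) g
  comp_id : ∀ {Xs : List Obj} {Y : Obj} (f : Hom Xs Y),
    HEq (comp (Fam.cons f Fam.nil) (id Y)) f
  assoc : ∀ {Xs : List (List (List Obj))} {Ys : List (List Obj)} {Zs : List Obj} {W : Obj}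
    (F : Fam (Fam Hom) Xs Ys) (G : Fam Hom Ys Zs) (h : Hom Zs W),
    HEq (comp (toPreMulticategory.compEach F G) h) (comp F.flatten (comp G h))


/-! ## The multicategory associated with a closed category -/

/-- The category of enriched functors `A → C` and enriched natural transformations. -/
instance VFunctor.category {C : ClosedCategory.{v, u}} (A : VCategory.{v, u, w} C) :
    Category (VFunctor A C.und) where
  Hom F G := VNatTrans F G
  id F :=
    { app := fun X => 𝟙 (F.obj X : C.carrier)
      naturality := fun X Y => by rw [C.post_id, C.pre_id] }
  comp {F G H} α β :=
    { app := fun X => α.app X ≫ β.app X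
      naturality := fun X Y => by
        rw [C.post_comp, C.pre_comp, reassoc_of% (α.naturality X Y), C.pre_post,
          reassoc_of% (β.naturality X Y)] }
  id_comp α := VNatTrans.ext (funext fun X => Category.id_comp (α.app X))
  comp_id α := VNatTrans.ext (funext fun X => Category.comp_id (α.app X))
  assoc α β δ :=
    VNatTrans.ext (funext fun X => Category.assoc (α.app X) (β.app X) (δ.app X))

namespace VFunctor

variable {C : ClosedCategory.{v, u}}

theorem hom_ext {A : VCategory.{v, u, w} C} {F G : VFunctor A C.und} {α β : F ⟶ G}
    (h : ∀ X, VNatTrans.app α X = VNatTrans.app β X) : α = β :=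
  VNatTrans.ext (funext h)

theorem map₀_id (G : VFunctor C.und C.und) (X : C.carrier) :
    G.map₀ (𝟙 X) = 𝟙 (G.obj X : C.carrier) := by
  apply C.γ_injective
  rw [G.γ_map₀, C.γ_id, C.γ_id]
  exact G.VF1 X

theorem map₀_comp (G : VFunctor C.und C.und) {X Y Z : C.carrier} (f : X ⟶ Y) (g : Y ⟶ Z) :
    G.map₀ (f ≫ g) = G.map₀ f ≫ G.map₀ g := by
  apply C.γ_injective
  rw [G.γ_map₀, ← C.γ_post, ← C.γ_post, G.γ_map₀, Category.assoc, G.post_map, Category.assoc]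

theorem id_map₀ {X Y : C.carrier} (f : X ⟶ Y) : (VFunctor.id C.und).map₀ f = f := by
  apply C.γ_injective
  rw [γ_map₀]
  exact Category.comp_id _

theorem comp_map₀ (G H : VFunctor C.und C.und) {X Y : C.carrier} (f : X ⟶ Y) :
    (G.comp H).map₀ f = H.map₀ (G.map₀ f) := by
  apply C.γ_injective
  rw [γ_map₀, γ_map₀, γ_map₀, Category.assoc]

theorem comp_assoc (F G H : VFunctor C.und C.und) :
    (F.comp G).comp H = F.comp (G.comp H) :=
  VFunctor.ext rfl (heq_of_eq (funext fun X => funext fun Y =>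
    Category.assoc (F.map X Y) (G.map _ _) (H.map _ _)))

theorem id_comp (F : VFunctor C.und C.und) : (VFunctor.id C.und).comp F = F :=
  VFunctor.ext rfl (heq_of_eq (funext fun X => funext fun Y => Category.id_comp (F.map X Y)))

theorem comp_id (F : VFunctor C.und C.und) : F.comp (VFunctor.id C.und) = F :=
  VFunctor.ext rfl (heq_of_eq (funext fun X => funext fun Y => Category.comp_id (F.map X Y)))

theorem app_naturality {G G' : VFunctor C.und C.und} (β : G ⟶ G') {X Y : C.carrier}
    (f : X ⟶ Y) : G.map₀ f ≫ VNatTrans.app β Y = VNatTrans.app β X ≫ G'.map₀ f := by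
  apply C.γ_injective
  rw [← C.γ_post, ← C.γ_pre, γ_map₀, γ_map₀, Category.assoc, Category.assoc]
  exact congrArg (fun t => C.γ f ≫ t) (VNatTrans.naturality β X Y)

/-- Horizontal composition of enriched natural transformations `α : F → F'` and
`β : G → G'`, the component at `X` being `G F X → G F' X → G' F' X`. -/
noncomputable def hcomp {F F' G G' : VFunctor C.und C.und} (α : F ⟶ F') (β : G ⟶ G') :
    F.comp G ⟶ F'.comp G' where
  app X := G.map₀ (VNatTrans.app α X) ≫ VNatTrans.app β (F'.obj X)
  naturality X Y := by
    change (F.map X Y ≫ G.map _ _) ≫ C.post (G.obj (F.obj X))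
        (G.map₀ (VNatTrans.app α Y) ≫ VNatTrans.app β (F'.obj Y)) =
      (F'.map X Y ≫ G'.map _ _) ≫ C.pre
        (G.map₀ (VNatTrans.app α X) ≫ VNatTrans.app β (F'.obj X)) (G'.obj (F'.obj Y))
    have h1 := G.post_map (X := F.obj X) (VNatTrans.app α Y)
    have h2 := G.pre_map (Z := F'.obj Y) (VNatTrans.app α X)
    have h3 := VNatTrans.naturality α X Y
    have h4 := VNatTrans.naturality β (F'.obj X) (F'.obj Y)
    rw [C.post_comp, C.pre_comp, Category.assoc, Category.assoc, ← reassoc_of% h1,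
      reassoc_of% h3, reassoc_of% h2, C.pre_post, reassoc_of% h4]

@[simp]
theorem category_id_app {A : VCategory.{v, u, w} C} (F : VFunctor A C.und) (X : A.Obj) :
    VNatTrans.app (𝟙 F) X = 𝟙 (F.obj X : C.carrier) := rfl

@[simp]
theorem category_comp_app {A : VCategory.{v, u, w} C} {F G H : VFunctor A C.und}
    (α : F ⟶ G) (β : G ⟶ H) (X : A.Obj) :
    VNatTrans.app (α ≫ β) X = VNatTrans.app α X ≫ VNatTrans.app β X := rfl

theorem hcomp_app {F F' G G' : VFunctor C.und C.und} (α : F ⟶ F') (β : G ⟶ G')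
    (X : C.carrier) : VNatTrans.app (hcomp α β) X =
      G.map₀ (VNatTrans.app α X) ≫ VNatTrans.app β (F'.obj X) := rfl

theorem eqToHom_app' {A : VCategory.{v, u, w} C} {F G : VFunctor A C.und} (h : F = G)
    (X : A.Obj) :
    VNatTrans.app (eqToHom h) X =
      eqToHom (X := (F.obj X : C.carrier)) (Y := (G.obj X : C.carrier)) (by rw [h]) := by
  subst h
  rfl

theorem hcomp_id (F G : VFunctor C.und C.und) : hcomp (𝟙 F) (𝟙 G) = 𝟙 (F.comp G) := by
  apply hom_ext
  intro X
  rw [hcomp_app, category_id_app, category_id_app, category_id_app]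
  erw [map₀_id]
  exact Category.comp_id _

theorem hcomp_comp {F F' F'' G G' G'' : VFunctor C.und C.und} (α : F ⟶ F') (α' : F' ⟶ F'')
    (β : G ⟶ G') (β' : G' ⟶ G'') :
    hcomp (α ≫ α') (β ≫ β') = hcomp α β ≫ hcomp α' β' := by
  apply hom_ext
  intro X
  simp only [hcomp_app, category_comp_app]
  erw [map₀_comp]
  have h := app_naturality β (VNatTrans.app α' X)
  simp only [Category.assoc]
  rw [reassoc_of% h]

theorem hcomp_eqToHom {F F' G G' : VFunctor C.und C.und} (h : F = F') (h' : G = G') :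
    hcomp (eqToHom h) (eqToHom h') = eqToHom (by rw [h, h']) := by
  subst h
  subst h'
  exact hcomp_id F G

theorem hcomp_assoc {F F' G G' H H' : VFunctor C.und C.und} (α : F ⟶ F') (β : G ⟶ G')
    (δ : H ⟶ H') : hcomp (hcomp α β) δ =
      eqToHom (comp_assoc F G H) ≫ hcomp α (hcomp β δ) ≫
        eqToHom (comp_assoc F' G' H').symm := by
  apply hom_ext
  intro X
  simp only [hcomp_app, category_comp_app, eqToHom_app']
  erw [Category.id_comp, Category.comp_id, comp_map₀, map₀_comp, Category.assoc]

theorem hcomp_id_left {G G' : VFunctor C.und C.und} (β : G ⟶ G') :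
    hcomp (𝟙 (VFunctor.id C.und)) β =
      eqToHom (id_comp G) ≫ β ≫ eqToHom (id_comp G').symm := by
  apply hom_ext
  intro X
  simp only [hcomp_app, category_comp_app, eqToHom_app', category_id_app]
  erw [Category.id_comp, Category.comp_id, map₀_id, Category.id_comp]

theorem hcomp_id_right {F F' : VFunctor C.und C.und} (α : F ⟶ F') :
    hcomp α (𝟙 (VFunctor.id C.und)) =
      eqToHom (comp_id F) ≫ α ≫ eqToHom (comp_id F').symm := by
  apply hom_ext
  intro X
  simp only [hcomp_app, category_comp_app, eqToHom_app', category_id_app]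
  erw [Category.id_comp, Category.comp_id, id_map₀, Category.comp_id]

end VFunctor

namespace ClosedCategory

variable (C : ClosedCategory.{v, u})

/-- The composite `L^{Xₙ} ∘ … ∘ L^{X₁}`. -/
def LL : List C.carrier → VFunctor C.und C.und
  | [] => VFunctor.id C.und
  | X :: Xs => (VFunctor.L C.und X).comp (LL Xs)

theorem LL_append (Xs Ys : List C.carrier) : C.LL (Xs ++ Ys) = (C.LL Xs).comp (C.LL Ys) := by
  induction Xs with
  | nil => exact (VFunctor.id_comp _).symm
  | cons X Xs ih =>
    change (VFunctor.L C.und X).comp (C.LL (Xs ++ Ys)) = _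
    rw [ih]
    exact (VFunctor.comp_assoc _ _ _).symm

/-- The underlying multigraph of the multicategory associated with `C`: morphisms
`X₁, …, Xₙ → Y` are enriched natural transformations `L^Y → L^{Xₙ} ∘ … ∘ L^{X₁}`. -/
@[reducible]
def multigraph : Multigraph.{max u v, u} where
  Obj := C.carrier
  Hom Xs Y := VFunctor.L C.und Y ⟶ C.LL Xs

/-- The horizontal composite of a family of enriched natural transformations. -/
noncomputable def hcompFam : {Xs : List (List C.carrier)} → {Ys : List C.carrier} →
    Fam C.multigraph.Hom Xs Ys → (C.LL Ys ⟶ C.LL Xs.flatten)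
  | _, _, Fam.nil => 𝟙 (C.LL [])
  | X :: Xs, Y :: _, Fam.cons f fs =>
    VFunctor.hcomp (F := VFunctor.L C.und Y) (F' := C.LL X) f (hcompFam fs) ≫
      eqToHom (C.LL_append X Xs.flatten).symm

/-- Identities and composition of the multicategory associated with `C`. -/
@[reducible]
noncomputable def premulticategory : PreMulticategory.{max u v, u} where
  toMultigraph := C.multigraph
  id X := eqToHom (VFunctor.comp_id (VFunctor.L C.und X)).symm
  comp fs g := g ≫ C.hcompFam fs

theorem conj_conj_eqToHom {K : Type u₁} [Category.{v₁} K] {X X₁ X₂ Y Y₁ Y₂ : K} (a : X = X₁)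
    (b : X₁ = X₂) (f : X₂ ⟶ Y₂) (c : Y₂ = Y₁) (d : Y₁ = Y) (a' : X = X₂) (d' : Y₂ = Y) :
    eqToHom a ≫ (eqToHom b ≫ f ≫ eqToHom c) ≫ eqToHom d =
      eqToHom a' ≫ f ≫ eqToHom d' := by
  subst a
  subst b
  subst c
  subst d
  simp

theorem heq_of_eqToHom {Xs Ys : List C.carrier} {F : VFunctor C.und C.und} (e : Xs = Ys)
    (f : F ⟶ C.LL Xs) (g : F ⟶ C.LL Ys) (h : f ≫ eqToHom (by rw [e]) = g) : HEq f g := by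
  subst e
  subst h
  simp

theorem flatten_map_singleton {α : Type u₁} (Xs : List α) :
    (Xs.map (fun X => [X])).flatten = Xs := by
  induction Xs with
  | nil => rfl
  | cons X Xs ih => simp [ih]

theorem hcompFam_ids (Xs : List C.carrier) :
    C.hcompFam (C.premulticategory.ids Xs) =
      eqToHom (congrArg C.LL (flatten_map_singleton Xs).symm) := by
  induction Xs with
  | nil => rfl
  | cons X Xs ih =>
    change VFunctor.hcomp (eqToHom (VFunctor.comp_id (VFunctor.L C.und X)).symm)
      (C.hcompFam (C.premulticategory.ids Xs)) ≫ eqToHom _ = _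
    rw [ih, VFunctor.hcomp_eqToHom]
    exact eqToHom_trans _ _

theorem hcompFam_append {Xs : List (List C.carrier)} {Ys : List C.carrier}
    {Xs' : List (List C.carrier)} {Ys' : List C.carrier}
    (fs : Fam C.multigraph.Hom Xs Ys) (gs : Fam C.multigraph.Hom Xs' Ys') :
    C.hcompFam (fs.append gs) =
      eqToHom (C.LL_append Ys Ys') ≫ VFunctor.hcomp (C.hcompFam fs) (C.hcompFam gs) ≫
        eqToHom (by rw [← C.LL_append, List.flatten_append]) := by
  induction fs with
  | nil =>
    change C.hcompFam gs = _ ≫ VFunctor.hcomp (𝟙 (VFunctor.id C.und)) _ ≫ _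
    rw [VFunctor.hcomp_id_left]
    exact ((conj_conj_eqToHom _ _ _ _ _ rfl rfl).trans (by simp)).symm
  | @cons X Y Xs Ys f fs ih =>
    change VFunctor.hcomp (F := VFunctor.L C.und Y) (F' := C.LL X) f
        (C.hcompFam (fs.append gs)) ≫ eqToHom _ =
      _ ≫ VFunctor.hcomp (VFunctor.hcomp (F := VFunctor.L C.und Y) (F' := C.LL X) f
        (C.hcompFam fs) ≫ eqToHom (C.LL_append X Xs.flatten).symm) (C.hcompFam gs) ≫ _
    have e1 : ∀ {F F' F'' G G' : VFunctor C.und C.und} (α : F ⟶ F') (h : F' = F'')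
        (β : G ⟶ G'), VFunctor.hcomp (α ≫ eqToHom h) β =
          VFunctor.hcomp α β ≫ eqToHom (by rw [h]) := by
      intro F F' F'' G G' α h β
      subst h
      simp
    have e2 : ∀ {F F' G₁ G G' G₂ : VFunctor C.und C.und} (α : F ⟶ F') (h : G₁ = G)
        (β : G ⟶ G') (h' : G' = G₂), VFunctor.hcomp α (eqToHom h ≫ β ≫ eqToHom h') =
          eqToHom (by rw [h]) ≫ VFunctor.hcomp α β ≫ eqToHom (by rw [h']) := by
      intro F F' G₁ G G' G₂ α h β h'
      subst h
      subst h'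
      simp
    rw [ih, e1, e2, VFunctor.hcomp_assoc]
    simp only [Category.assoc, eqToHom_trans]
    exact (eqToHom_trans_assoc _ _ _).symm

theorem hcompFam_assoc {Xs : List (List (List C.carrier))} {Ys : List (List C.carrier)}
    {Zs : List C.carrier} (F : Fam (Fam C.multigraph.Hom) Xs Ys)
    (G : Fam C.multigraph.Hom Ys Zs) :
    C.hcompFam (C.premulticategory.compEach F G) =
      C.hcompFam G ≫ C.hcompFam F.flatten ≫
        eqToHom (congrArg C.LL List.flatten_flatten) := by
  induction F generalizing Zs with
  | nil =>
    cases G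
    change 𝟙 _ = 𝟙 _ ≫ 𝟙 _ ≫ eqToHom _
    simp
  | @cons X Y Xs Ys f fs ih =>
    cases G with
    | @cons _ Z _ Zs g gs =>
    change VFunctor.hcomp (F := VFunctor.L C.und Z) (F' := C.LL X.flatten)
        (g ≫ C.hcompFam f)
        (C.hcompFam (C.premulticategory.compEach fs gs)) ≫ eqToHom _ =
      (VFunctor.hcomp (F := VFunctor.L C.und Z) (F' := C.LL Y) g (C.hcompFam gs) ≫
        eqToHom (C.LL_append Y Ys.flatten).symm) ≫ C.hcompFam (f.append fs.flatten) ≫ _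
    rw [ih gs, hcompFam_append, VFunctor.hcomp_comp]
    have e : ∀ {F F' G G' G₂ : VFunctor C.und C.und} (α : F ⟶ F')
        (β : G ⟶ G') (h' : G' = G₂), VFunctor.hcomp α (β ≫ eqToHom h') =
          VFunctor.hcomp α β ≫ eqToHom (by rw [h']) := by
      intro F F' G G' G₂ α β h'
      subst h'
      simp
    rw [e]
    simp

/-- The multicategory associated with a closed category `C`. -/
noncomputable def multicategory : Multicategory.{max u v, u} where
  toPreMulticategory := C.premulticategory
  id_comp {Ys Z} g := by
    apply C.heq_of_eqToHom (flatten_map_singleton Ys)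
    change (g ≫
      C.hcompFam (C.premulticategory.ids Ys)) ≫ eqToHom _ = _
    rw [hcompFam_ids]
    simp
  comp_id {Xs Y} f := by
    apply C.heq_of_eqToHom (by simp)
    change ((eqToHom (VFunctor.comp_id (VFunctor.L C.und Y)).symm) ≫
      VFunctor.hcomp (F := VFunctor.L C.und Y) (F' := C.LL Xs) f (𝟙 (VFunctor.id C.und)) ≫
        eqToHom _) ≫ eqToHom _ = f
    rw [VFunctor.hcomp_id_right]
    simp only [Category.assoc, eqToHom_trans_assoc, eqToHom_refl, Category.id_comp]
    erw [eqToHom_trans, eqToHom_trans, eqToHom_refl, Category.comp_id]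
  assoc {Xs Ys Zs W} F G h := by
    apply C.heq_of_eqToHom List.flatten_flatten.symm
    change (h ≫
      C.hcompFam (C.premulticategory.compEach F G)) ≫ eqToHom _ =
      (h ≫ C.hcompFam G) ≫ C.hcompFam F.flatten
    rw [hcompFam_assoc]
    simp

end ClosedCategory

/-! ## Closed multicategories -/

namespace Multicategory

variable (M : Multicategory.{v, u})

/-- A morphism regarded as a morphism with an equal source. -/
def castHom {Xs Ys : List M.Obj} {Z : M.Obj} (e : Xs = Ys) (f : M.Hom Xs Z) : M.Hom Ys Z :=
  cast (congrArg (fun Ws => M.Hom Ws Z) e) f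

theorem flatten_map_singleton_append {α : Type u₁} (Xs Ys : List α) :
    (Xs.map (fun X => [X]) ++ [Ys]).flatten = Xs ++ Ys := by
  induction Xs with
  | nil => simp
  | cons X Xs ih => simpa using ih

/-- For a morphism `ev : X₁, …, Xₘ, H → Z`, the map
`φ : M(Y₁, …, Yₙ; H) → M(X₁, …, Xₘ, Y₁, …, Yₙ; Z)`, `f ↦ (1, …, 1, f) · ev`. -/
def phi (Xs : List M.Obj) {H Z : M.Obj} (ev : M.Hom (Xs ++ [H]) Z) {Ys : List M.Obj}
    (f : M.Hom Ys H) : M.Hom (Xs ++ Ys) Z :=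
  M.castHom (flatten_map_singleton_append Xs Ys)
    (M.comp (M.idsAppend Xs (Fam.cons f Fam.nil)) ev)

/-- A multicategory is closed if it has all internal `Hom`-objects. -/
def IsClosed : Prop :=
  ∀ (Xs : List M.Obj) (Z : M.Obj), ∃ (H : M.Obj) (ev : M.Hom (Xs ++ [H]) Z),
    ∀ Ys : List M.Obj, Function.Bijective (fun f : M.Hom Ys H => M.phi Xs ev f)

/-- A choice of internal `Hom`-objects and of evaluation morphisms in a closed multicategory. -/
structure InternalHoms where
  ihom : List M.Obj → M.Obj → M.Obj
  ev : ∀ (Xs : List M.Obj) (Z : M.Obj), M.Hom (Xs ++ [ihom Xs Z]) Z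
  bijective : ∀ (Xs : List M.Obj) (Z : M.Obj) (Ys : List M.Obj),
    Function.Bijective (fun f : M.Hom Ys (ihom Xs Z) => M.phi Xs (ev Xs Z) f)

/-- The composite `X₁, …, Xₙ → A → B`. -/
def post1 {Γ : List M.Obj} {A B : M.Obj} (f : M.Hom Γ A) (g : M.Hom [A] B) : M.Hom Γ B :=
  M.castHom (by simp) (M.comp (Fam.cons f Fam.nil) g)

/-- The composite `(f, g) · k`. -/
def sub2 {Γ Δ : List M.Obj} {A B Z : M.Obj} (f : M.Hom Γ A) (g : M.Hom Δ B)
    (k : M.Hom [A, B] Z) : M.Hom (Γ ++ Δ) Z :=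
  M.castHom (by simp) (M.comp (Fam.cons f (Fam.cons g Fam.nil)) k)

variable {M}

theorem castHom_heq {Xs Ys : List M.Obj} {Z : M.Obj} (e : Xs = Ys) (f : M.Hom Xs Z) :
    HEq (M.castHom e f) f :=
  cast_heq _ _

theorem comp1_congr {Γ Γ' : List M.Obj} {A Z : M.Obj} {f : M.Hom Γ A} {f' : M.Hom Γ' A}
    (k : M.Hom [A] Z) (e : Γ = Γ') (h : HEq f f') :
    HEq (M.comp (Fam.cons f Fam.nil) k) (M.comp (Fam.cons f' Fam.nil) k) := by
  subst e
  subst h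
  rfl

theorem comp2_congr {Γ Γ' Δ Δ' : List M.Obj} {A B Z : M.Obj} {f : M.Hom Γ A}
    {f' : M.Hom Γ' A} {g : M.Hom Δ B} {g' : M.Hom Δ' B}
    (k : M.Hom [A, B] Z) (e : Γ = Γ') (h : HEq f f') (e' : Δ = Δ') (h' : HEq g g') :
    HEq (M.comp (Fam.cons f (Fam.cons g Fam.nil)) k)
      (M.comp (Fam.cons f' (Fam.cons g' Fam.nil)) k) := by
  subst e
  subst h
  subst e'
  subst h'
  rfl

theorem post1_heq {Γ : List M.Obj} {A B : M.Obj} (f : M.Hom Γ A) (g : M.Hom [A] B) :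
    HEq (M.post1 f g) (M.comp (Fam.cons f Fam.nil) g) :=
  castHom_heq _ _

theorem sub2_heq {Γ Δ : List M.Obj} {A B Z : M.Obj} (f : M.Hom Γ A) (g : M.Hom Δ B)
    (k : M.Hom [A, B] Z) :
    HEq (M.sub2 f g k) (M.comp (Fam.cons f (Fam.cons g Fam.nil)) k) :=
  castHom_heq _ _

theorem post1_id {Γ : List M.Obj} {A : M.Obj} (f : M.Hom Γ A) : M.post1 f (M.id A) = f :=
  eq_of_heq ((post1_heq _ _).trans (M.comp_id f))

theorem id_post1 {A B : M.Obj} (f : M.Hom [A] B) : M.post1 (M.id A) f = f :=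
  eq_of_heq ((post1_heq _ _).trans (M.id_comp f))

theorem post1_assoc {Γ : List M.Obj} {A B D : M.Obj} (f : M.Hom Γ A) (g : M.Hom [A] B)
    (h : M.Hom [B] D) : M.post1 (M.post1 f g) h = M.post1 f (M.post1 g h) := by
  apply eq_of_heq
  refine (post1_heq _ _).trans ?_
  refine HEq.trans ?_ (post1_heq f (M.post1 g h)).symm
  refine (comp1_congr h (by simp) (post1_heq f g)).trans ?_
  exact M.assoc (Fam.cons (Fam.cons f Fam.nil) Fam.nil) (Fam.cons g Fam.nil) h

theorem sub2_sub2 {Γ Δ : List M.Obj} {A A' B B' Z : M.Obj} (a : M.Hom Γ A) (b : M.Hom Δ B)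
    (f : M.Hom [A] A') (g : M.Hom [B] B') (k : M.Hom [A', B'] Z) :
    M.sub2 a b (M.sub2 f g k) = M.sub2 (M.post1 a f) (M.post1 b g) k := by
  apply eq_of_heq
  refine HEq.symm ?_
  refine (sub2_heq _ _ _).trans ?_
  refine HEq.trans ?_ (sub2_heq a b (M.sub2 f g k)).symm
  refine (comp2_congr k (by simp) (post1_heq a f) (by simp) (post1_heq b g)).trans ?_
  exact M.assoc (Fam.cons (Fam.cons a Fam.nil) (Fam.cons (Fam.cons b Fam.nil) Fam.nil))
    (Fam.cons f (Fam.cons g Fam.nil)) k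

theorem post1_sub2 {Γ Δ : List M.Obj} {A B Z W : M.Obj} (a : M.Hom Γ A) (b : M.Hom Δ B)
    (k : M.Hom [A, B] Z) (g : M.Hom [Z] W) :
    M.post1 (M.sub2 a b k) g = M.sub2 a b (M.post1 k g) := by
  apply eq_of_heq
  refine (post1_heq _ _).trans ?_
  refine HEq.trans ?_ (sub2_heq a b (M.post1 k g)).symm
  refine (comp1_congr g (by simp) (sub2_heq a b k)).trans ?_
  exact M.assoc (Fam.cons (Fam.cons a (Fam.cons b Fam.nil)) Fam.nil) (Fam.cons k Fam.nil) g

/-- The underlying category of a multicategory. -/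
instance category (M : Multicategory.{v, u}) : Category.{v, u} M.Obj where
  Hom X Y := M.Hom [X] Y
  id X := M.id X
  comp f g := M.post1 f g
  id_comp f := id_post1 f
  comp_id f := post1_id f
  assoc f g h := post1_assoc f g h

namespace InternalHoms

variable (c : M.InternalHoms)

/-- The internal `Hom`-object of a pair of objects. -/
abbrev H (X Z : M.Obj) : M.Obj := c.ihom [X] Z

/-- The evaluation `X, [X, Z] → Z`. -/
abbrev ev1 (X Z : M.Obj) : M.Hom [X, c.H X Z] Z := c.ev [X] Z

/-- The morphism `⟨f⟩ : Y₁, …, Yₙ → [X, Z]` corresponding to `f : X, Y₁, …, Yₙ → Z`; it is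
characterized by `(1, ⟨f⟩) · ev = f`. -/
noncomputable def lam {X Z : M.Obj} {Ys : List M.Obj} (f : M.Hom (X :: Ys) Z) :
    M.Hom Ys (c.H X Z) :=
  ((c.bijective [X] Z Ys).2 f).choose

variable {c}

theorem sub2_lam {X Z : M.Obj} {Ys : List M.Obj} (f : M.Hom (X :: Ys) Z) :
    M.sub2 (M.id X) (c.lam f) (c.ev1 X Z) = f :=
  ((c.bijective [X] Z Ys).2 f).choose_spec

theorem hom_ext {X Z : M.Obj} {Ys : List M.Obj} {p q : M.Hom Ys (c.H X Z)}
    (h : M.sub2 (M.id X) p (c.ev1 X Z) = M.sub2 (M.id X) q (c.ev1 X Z)) : p = q :=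
  (c.bijective [X] Z Ys).1 h

theorem beta0 {Γ : List M.Obj} {X Z : M.Obj} (a : M.Hom Γ X) (k : M.Hom [X] Z) :
    HEq (M.sub2 a (c.lam k) (c.ev1 X Z)) (M.post1 a k) := by
  refine (sub2_heq _ _ _).trans ?_
  refine HEq.trans ?_ (post1_heq a k).symm
  have h := M.assoc
    (Fam.cons (Fam.cons a Fam.nil) (Fam.cons Fam.nil Fam.nil) :
      Fam (Fam M.Hom) [[Γ], []] [[X], []])
    (Fam.cons (M.id X) (Fam.cons (c.lam k) Fam.nil)) (c.ev1 X Z)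
  have e : M.comp (Fam.cons (M.id X) (Fam.cons (c.lam k) Fam.nil)) (c.ev1 X Z) = k :=
    sub2_lam k
  rw [e] at h
  refine HEq.trans ?_ h
  exact comp2_congr _ (by simp) (M.comp_id a).symm rfl (M.id_comp (c.lam k)).symm

theorem beta1 {Γ Δ : List M.Obj} {X B Z : M.Obj} (a : M.Hom Γ X) (h : M.Hom Δ B)
    (k : M.Hom [X, B] Z) :
    M.sub2 a (M.post1 h (c.lam k)) (c.ev1 X Z) = M.sub2 a h k := by
  have h1 := sub2_sub2 a h (M.id X) (c.lam k) (c.ev1 X Z)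
  rw [post1_id] at h1
  rw [← h1]
  exact congrArg (M.sub2 a h) (sub2_lam k)

/-- The morphism `ev · ev : X, [X, Y], [Y, Z] → Z`. -/
abbrev evev (c : M.InternalHoms) (X Y Z : M.Obj) : M.Hom [X, c.H X Y, c.H Y Z] Z :=
  M.sub2 (c.ev1 X Y) (M.id (c.H Y Z)) (c.ev1 Y Z)

theorem beta2 {Γ Δ Θ : List M.Obj} {X Y Z : M.Obj} (a : M.Hom Γ X) (f : M.Hom Δ (c.H X Y))
    (g : M.Hom Θ (c.H Y Z)) :
    HEq (M.sub2 a (M.sub2 f g (c.lam (c.evev X Y Z))) (c.ev1 X Z))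
      (M.sub2 (M.sub2 a f (c.ev1 X Y)) g (c.ev1 Y Z)) := by
  refine (sub2_heq _ _ _).trans ?_
  refine HEq.trans ?_ (sub2_heq (M.sub2 a f (c.ev1 X Y)) g (c.ev1 Y Z)).symm
  have e : M.comp (Fam.cons (M.id X) (Fam.cons (c.lam (c.evev X Y Z)) Fam.nil)) (c.ev1 X Z) =
      M.comp (Fam.cons (c.ev1 X Y) (Fam.cons (M.id (c.H Y Z)) Fam.nil)) (c.ev1 Y Z) :=
    sub2_lam (c.evev X Y Z)
  have h1 := M.assoc
    (Fam.cons (Fam.cons a Fam.nil) (Fam.cons (Fam.cons f (Fam.cons g Fam.nil)) Fam.nil) :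
      Fam (Fam M.Hom) [[Γ], [Δ, Θ]] [[X], [c.H X Y, c.H Y Z]])
    (Fam.cons (M.id X) (Fam.cons (c.lam (c.evev X Y Z)) Fam.nil)) (c.ev1 X Z)
  have h2 := M.assoc
    (Fam.cons (Fam.cons a (Fam.cons f Fam.nil)) (Fam.cons (Fam.cons g Fam.nil) Fam.nil) :
      Fam (Fam M.Hom) [[Γ, Δ], [Θ]] [[X, c.H X Y], [c.H Y Z]])
    (Fam.cons (c.ev1 X Y) (Fam.cons (M.id (c.H Y Z)) Fam.nil)) (c.ev1 Y Z)
  rw [e] at h1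
  refine HEq.trans ?_ ((h1.trans h2.symm).trans ?_)
  · exact comp2_congr _ (by simp) (M.comp_id a).symm (by simp) (sub2_heq f g _)
  · exact comp2_congr _ (by simp) (sub2_heq a f _).symm (by simp) (M.comp_id g)

variable (c)

/-- The morphism `[f, 1] : [X', Z] → [X, Z]`, determined by
`(1, [f, 1]) · ev = (f, 1) · ev`. -/
noncomputable def pre {X X' : M.Obj} (f : X ⟶ X') (Z : M.Obj) : c.H X' Z ⟶ c.H X Z :=
  c.lam (M.sub2 (show M.Hom [X] X' from f) (M.id (c.H X' Z)) (c.ev1 X' Z))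

/-- The morphism `[1, g] : [X, Z] → [X, Z']`, determined by `(1, [1, g]) · ev = ev · g`. -/
noncomputable def post (X : M.Obj) {Z Z' : M.Obj} (g : Z ⟶ Z') : c.H X Z ⟶ c.H X Z' :=
  c.lam (M.post1 (c.ev1 X Z) g)

/-- The composition `μ : [X, Y], [Y, Z] → [X, Z]`, determined by
`(1, μ) · ev = (ev, 1) · ev`. -/
noncomputable def mu (X Y Z : M.Obj) : M.Hom [c.H X Y, c.H Y Z] (c.H X Z) :=
  c.lam (c.evev X Y Z)

/-- The morphism `L : [Y, Z] → [[X, Y], [X, Z]]`, determined by `(1, L) · ev = μ`. -/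
noncomputable def L (X Y Z : M.Obj) : c.H Y Z ⟶ c.H (c.H X Y) (c.H X Z) :=
  c.lam (c.mu X Y Z)

/-- The morphism `() → [X, X]` corresponding to the identity of `X`. -/
noncomputable def one (X : M.Obj) : M.Hom [] (c.H X X) := c.lam (M.id X)

variable {c}

theorem app_pre {Γ Δ : List M.Obj} {X X' Z : M.Obj} (a : M.Hom Γ X) (h : M.Hom Δ (c.H X' Z))
    (f : X ⟶ X') :
    M.sub2 a (M.post1 h (c.pre f Z)) (c.ev1 X Z) = M.sub2 (M.post1 a f) h (c.ev1 X' Z) := by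
  refine (beta1 a h _).trans ?_
  rw [sub2_sub2, post1_id]

theorem app_post {Γ Δ : List M.Obj} {X Z Z' : M.Obj} (a : M.Hom Γ X) (h : M.Hom Δ (c.H X Z))
    (g : Z ⟶ Z') :
    M.sub2 a (M.post1 h (c.post X g)) (c.ev1 X Z') = M.post1 (M.sub2 a h (c.ev1 X Z)) g := by
  refine (beta1 a h _).trans ?_
  rw [post1_sub2]

theorem app_one {Γ : List M.Obj} {X : M.Obj} (a : M.Hom Γ X) :
    HEq (M.sub2 a (c.one X) (c.ev1 X X)) a :=
  (beta0 a (M.id X)).trans (heq_of_eq (post1_id a))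

theorem app_L {Δ Θ : List M.Obj} {X Y Z : M.Obj} (f : M.Hom Δ (c.H X Y))
    (g : M.Hom Θ (c.H Y Z)) :
    M.sub2 f (M.post1 g (c.L X Y Z)) (c.ev1 _ _) = M.sub2 f g (c.mu X Y Z) :=
  beta1 f g _

theorem app_app_L {Γ Δ Θ : List M.Obj} {X Y Z : M.Obj} (a : M.Hom Γ X)
    (f : M.Hom Δ (c.H X Y)) (g : M.Hom Θ (c.H Y Z)) :
    HEq (M.sub2 a (M.sub2 f (M.post1 g (c.L X Y Z)) (c.ev1 _ _)) (c.ev1 X Z))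
      (M.sub2 (M.sub2 a f (c.ev1 X Y)) g (c.ev1 Y Z)) := by
  rw [app_L]
  exact beta2 a f g

/-- The internal `Hom`-functor. -/
noncomputable def ihomFunctor (c : M.InternalHoms) : M.Objᵒᵖ ⥤ M.Obj ⥤ M.Obj where
  obj X :=
    { obj := fun Z => c.H X.unop Z
      map := fun g => c.post X.unop g
      map_id := fun Z => by
        apply hom_ext
        have h := app_post (c := c) (M.id X.unop) (M.id (c.H X.unop Z)) (𝟙 Z)
        rw [id_post1] at h
        exact h.trans (post1_id _)
      map_comp := fun {Z Z' Z''} f g => by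
        apply hom_ext
        have h := app_post (c := c) (M.id X.unop) (M.id (c.H X.unop Z)) (f ≫ g)
        rw [id_post1] at h
        refine h.trans ((post1_assoc _ f g).symm.trans ?_)
        refine Eq.trans ?_ (app_post (c := c) (M.id X.unop) (c.post X.unop f) g).symm
        have h' := app_post (c := c) (M.id X.unop) (M.id (c.H X.unop Z)) f
        rw [id_post1] at h'
        rw [h'] }
  map {X X'} f :=
    { app := fun Z => c.pre f.unop Z
      naturality := fun Z Z' g => by
        apply hom_ext
        refine (app_pre (c := c) (M.id X'.unop) (c.post X.unop g) f.unop).trans ?_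
        refine Eq.trans ?_ (app_post (c := c) (M.id X'.unop) (c.pre f.unop Z) g).symm
        have h := app_post (c := c) (M.post1 (M.id X'.unop) f.unop) (M.id (c.H X.unop Z)) g
        have h' := app_pre (c := c) (M.id X'.unop) (M.id (c.H X.unop Z)) f.unop
        rw [id_post1 (c.post X.unop g)] at h
        rw [id_post1 (c.pre f.unop Z)] at h'
        rw [h, h'] }
  map_id X := by
    apply NatTrans.ext
    funext Z
    apply hom_ext
    have h := app_pre (c := c) (M.id X.unop) (M.id (c.H X.unop Z)) (𝟙 X.unop)
    rw [id_post1 (c.pre (𝟙 X.unop) Z)] at h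
    exact h.trans (congrArg (fun t => M.sub2 t _ _) (post1_id _))
  map_comp {X X' X''} f g := by
    apply NatTrans.ext
    funext Z
    apply hom_ext
    have h := app_pre (c := c) (M.id X''.unop) (M.id (c.H X.unop Z)) (g.unop ≫ f.unop)
    rw [id_post1 (c.pre (g.unop ≫ f.unop) Z)] at h
    refine h.trans ?_
    refine Eq.trans ?_ (app_pre (c := c) (M.id X''.unop) (c.pre f.unop Z) g.unop).symm
    have h' := app_pre (c := c) (M.post1 (M.id X''.unop) g.unop) (M.id (c.H X.unop Z)) f.unop
    rw [id_post1 (c.pre f.unop Z)] at h'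
    rw [h', post1_assoc]
    rfl

end InternalHoms

end Multicategory

namespace Multicategory.InternalHoms

variable {M : Multicategory.{v, u}} (c : M.InternalHoms)

/-- The morphism `[u, 1] : [I, X] → [; X] = X` induced by `u : () → I`, that is, the
composite `(u, 1) · ev` (for the empty sequence of arguments one takes `[; X] = X` and
`ev = 1`). -/
def undU {I : M.Obj} (u : M.Hom [] I) (X : M.Obj) : c.H I X ⟶ X :=
  M.sub2 u (M.id (c.H I X)) (c.ev1 I X)

/-- An object `I` together with a morphism `u : () → I` is a unit object if
`[u, 1] : [I, X] → [; X] = X` is an isomorphism for each `X`. -/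
def IsUnit (I : M.Obj) (u : M.Hom [] I) : Prop :=
  ∀ X : M.Obj, IsIso (c.undU u X)

variable {c} {I : M.Obj} {u : M.Hom [] I}

theorem app_undU {Δ : List M.Obj} {X : M.Obj} (u : M.Hom [] I) (h : M.Hom Δ (c.H I X)) :
    M.sub2 u h (c.ev1 I X) = M.post1 h (c.undU u X) := by
  apply eq_of_heq
  refine (sub2_heq _ _ _).trans ?_
  refine HEq.trans ?_ (post1_heq h (c.undU u X)).symm
  have h1 := M.assoc
    (Fam.cons Fam.nil (Fam.cons (Fam.cons h Fam.nil) Fam.nil) :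
      Fam (Fam M.Hom) [[], [Δ]] [[], [c.H I X]])
    (Fam.cons u (Fam.cons (M.id (c.H I X)) Fam.nil)) (c.ev1 I X)
  refine HEq.trans ?_ h1
  exact comp2_congr _ rfl (M.id_comp u).symm (by simp) (M.comp_id h).symm

theorem post1_unit (u : M.Hom [] I) {X : M.Obj} (f : M.Hom [I] X) :
    M.post1 u f = M.post1 (c.lam f) (c.undU u X) :=
  (eq_of_heq (beta0 (c := c) u f)).symm.trans (app_undU u (c.lam f))

theorem post1_iso_cancel {Δ : List M.Obj} {X Y : M.Obj} (g : X ⟶ Y) [IsIso g]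
    (f : M.Hom Δ X) : M.post1 (M.post1 f g) (inv g) = f := by
  rw [post1_assoc]
  exact (congrArg (M.post1 f) (IsIso.hom_inv_id g)).trans (post1_id f)

theorem post1_iso_cancel' {Δ : List M.Obj} {X Y : M.Obj} (g : X ⟶ Y) [IsIso g]
    (f : M.Hom Δ Y) : M.post1 (M.post1 f (inv g)) g = f := by
  rw [post1_assoc]
  exact (congrArg (M.post1 f) (IsIso.inv_hom_id g)).trans (post1_id f)

theorem IsUnit.hom_ext (hu : c.IsUnit I u) {X : M.Obj} {f g : M.Hom [I] X}
    (h : M.post1 u f = M.post1 u g) : f = g := by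
  have := hu X
  rw [post1_unit (c := c) u f, post1_unit (c := c) u g] at h
  have h' : c.lam f = c.lam g := by
    rw [← post1_iso_cancel (c.undU u X) (c.lam f), h, post1_iso_cancel]
  rw [← sub2_lam (c := c) f, ← sub2_lam (c := c) g, h']

theorem IsUnit.bijective (hu : c.IsUnit I u) (X : M.Obj) :
    Function.Bijective (fun f : M.Hom [I] X => M.post1 u f) := by
  have := hu X
  refine ⟨fun f g h => hu.hom_ext h, fun h => ⟨M.sub2 (M.id I)
    (M.post1 h (inv (c.undU u X))) (c.ev1 I X), ?_⟩⟩
  have e : c.lam (M.sub2 (M.id I) (M.post1 h (inv (c.undU u X))) (c.ev1 I X)) =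
      M.post1 h (inv (c.undU u X)) := InternalHoms.hom_ext (sub2_lam _)
  refine (post1_unit (c := c) u _).trans ?_
  refine (congrArg (fun t => M.post1 t (c.undU u X)) e).trans ?_
  exact post1_iso_cancel' _ h

/-- For a unit object `(I, u)` and a morphism `f : () → X`, the unique morphism
`bar f : I → X` such that `u · bar f = f`. -/
noncomputable def IsUnit.bar (hu : c.IsUnit I u) {X : M.Obj} (f : M.Hom [] X) : I ⟶ X :=
  ((hu.bijective X).2 f).choose

theorem IsUnit.post1_bar (hu : c.IsUnit I u) {X : M.Obj} (f : M.Hom [] X) :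
    M.post1 u (hu.bar f) = f :=
  ((hu.bijective X).2 f).choose_spec

theorem comp_def {X Y Z : M.Obj} (f : X ⟶ Y) (g : Y ⟶ Z) : f ≫ g = M.post1 f g := rfl

theorem undU_natural (u : M.Hom [] I) {X Y : M.Obj} (g : X ⟶ Y) :
    c.post I g ≫ c.undU u Y = c.undU u X ≫ g := by
  rw [comp_def, comp_def, ← app_undU]
  have h := app_post (c := c) u (M.id (c.H I X)) g
  rw [id_post1 (c.post I g)] at h
  exact h

/-- The isomorphism `i`, inverse to `[u, 1]`. -/
noncomputable def IsUnit.i (hu : c.IsUnit I u) : 𝟭 M.Obj ≅ c.ihomFunctor.obj (op I) :=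
  NatIso.ofComponents
    (fun X =>
      haveI := hu X
      (asIso (c.undU u X)).symm)
    (fun {X Y} f => by
      have := hu X
      have := hu Y
      change f ≫ inv (c.undU u Y) = inv (c.undU u X) ≫ c.post I f
      rw [IsIso.comp_inv_eq, Category.assoc, undU_natural, IsIso.inv_hom_id_assoc])

theorem IsUnit.i_undU (hu : c.IsUnit I u) (X : M.Obj) :
    hu.i.hom.app X ≫ c.undU u X = 𝟙 X := by
  have := hu X
  exact IsIso.inv_hom_id (c.undU u X)

theorem IsUnit.undU_i (hu : c.IsUnit I u) (X : M.Obj) :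
    c.undU u X ≫ hu.i.hom.app X = 𝟙 (c.H I X) := by
  have := hu X
  exact IsIso.hom_inv_id (c.undU u X)

/-- The morphism `j_X : I → [X, X]`, determined by `u · j_X = one X`. -/
noncomputable def IsUnit.j (hu : c.IsUnit I u) (X : M.Obj) : I ⟶ c.H X X :=
  hu.bar (c.one X)

theorem app_pre' {Γ : List M.Obj} {X X' Z : M.Obj} (a : M.Hom Γ X) (f : X ⟶ X') :
    M.sub2 a (c.pre f Z) (c.ev1 X Z) = M.sub2 (M.post1 a f) (M.id _) (c.ev1 X' Z) := by
  have h := app_pre (c := c) a (M.id (c.H X' Z)) f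
  rwa [id_post1 (c.pre f Z)] at h

theorem app_post' {Γ : List M.Obj} {X Z Z' : M.Obj} (a : M.Hom Γ X) (g : Z ⟶ Z') :
    M.sub2 a (c.post X g) (c.ev1 X Z') = M.post1 (M.sub2 a (M.id _) (c.ev1 X Z)) g := by
  have h := app_post (c := c) a (M.id (c.H X Z)) g
  rwa [id_post1 (c.post X g)] at h

theorem app_app_L' {Γ Δ : List M.Obj} {X Y Z : M.Obj} (a : M.Hom Γ X)
    (f : M.Hom Δ (c.H X Y)) :
    HEq (M.sub2 a (M.sub2 f (c.L X Y Z) (c.ev1 _ _)) (c.ev1 X Z))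
      (M.sub2 (M.sub2 a f (c.ev1 X Y)) (M.id (c.H Y Z)) (c.ev1 Y Z)) := by
  have h := app_app_L (c := c) a f (M.id (c.H Y Z))
  rwa [id_post1 (c.L X Y Z)] at h

theorem one_pre {X Y : M.Obj} (f : X ⟶ Y) :
    M.post1 (c.one Y) (c.pre f Y) = M.post1 (c.one X) (c.post X f) := by
  apply InternalHoms.hom_ext
  rw [app_pre, app_post]
  have h1 := eq_of_heq (app_one (c := c) (M.post1 (M.id X) f))
  have h2 := eq_of_heq (app_one (c := c) (M.id X))
  refine h1.trans ?_
  exact congrArg (fun t => M.post1 t f) h2.symm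

theorem L_post_undU (u : M.Hom [] I) (Y Z : M.Obj) :
    c.L I Y Z ≫ c.post (c.H I Y) (c.undU u Z) = c.pre (c.undU u Y) Z := by
  apply InternalHoms.hom_ext
  rw [comp_def, app_post, app_pre', ← app_undU, ← app_undU]
  exact eq_of_heq (app_app_L' (c := c) u (M.id (c.H I Y)))

theorem L_natural_left (X : M.Obj) {Y Y' : M.Obj} (g : Y ⟶ Y') (Z : M.Obj) :
    c.pre g Z ≫ c.L X Y Z = c.L X Y' Z ≫ c.pre (c.post X g) (c.H X Z) := by
  apply InternalHoms.hom_ext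
  apply InternalHoms.hom_ext
  rw [comp_def, comp_def, app_pre]
  refine (eq_of_heq (app_app_L (M.id X) (M.id (c.H X Y)) (c.pre g Z))).trans ?_
  refine Eq.trans ?_
    (eq_of_heq (app_app_L' (M.id X) (M.post1 (M.id (c.H X Y)) (c.post X g)))).symm
  rw [app_pre', app_post]

theorem L_natural_right (X Y : M.Obj) {Z Z' : M.Obj} (h : Z ⟶ Z') :
    c.post Y h ≫ c.L X Y Z' = c.L X Y Z ≫ c.post (c.H X Y) (c.post X h) := by
  apply InternalHoms.hom_ext
  apply InternalHoms.hom_ext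
  rw [comp_def, comp_def, app_post, app_post]
  refine (eq_of_heq (app_app_L (M.id X) (M.id (c.H X Y)) (c.post Y h))).trans ?_
  refine Eq.trans ?_ (congrArg (fun t : M.Hom [X, c.H X Y, c.H Y Z] Z => M.post1 t h)
    (eq_of_heq (app_app_L' (M.id X) (M.id (c.H X Y))))).symm
  rw [app_post']

theorem L_dinatural {X X' : M.Obj} (f : X ⟶ X') (Y Z : M.Obj) :
    c.L X' Y Z ≫ c.post (c.H X' Y) (c.pre f Z) =
      c.L X Y Z ≫ c.pre (c.pre f Y) (c.H X Z) := by
  apply InternalHoms.hom_ext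
  apply InternalHoms.hom_ext
  rw [comp_def, comp_def, app_post, app_pre, app_pre]
  refine (eq_of_heq (app_app_L' (M.post1 (M.id X) f) (M.id (c.H X' Y)))).trans ?_
  refine Eq.trans ?_
    (eq_of_heq (app_app_L' (M.id X) (M.post1 (M.id (c.H X' Y)) (c.pre f Y)))).symm
  rw [app_pre]

theorem IsUnit.CC1 (hu : c.IsUnit I u) (X Y : M.Obj) :
    hu.j Y ≫ c.L X Y Y = hu.j (c.H X Y) := by
  apply hu.hom_ext
  rw [comp_def, ← post1_assoc]
  unfold IsUnit.j
  rw [hu.post1_bar, hu.post1_bar]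
  apply InternalHoms.hom_ext
  apply InternalHoms.hom_ext
  refine (eq_of_heq (app_app_L (M.id X) (M.id (c.H X Y)) (c.one Y))).trans ?_
  refine (eq_of_heq (app_one (M.sub2 (M.id X) (M.id (c.H X Y)) (c.ev1 X Y)))).trans ?_
  exact congrArg (fun t : M.Hom [c.H X Y] (c.H X Y) => M.sub2 (M.id X) t (c.ev1 X Y))
    (eq_of_heq (app_one (M.id (c.H X Y)))).symm

theorem comp_inv_unique {K : Type u₁} [Category.{v₁} K] {X Y : K} (f : X ⟶ Y) (g : Y ⟶ X)
    (h : X ⟶ Y) (e : f ≫ g = 𝟙 X) (e' : g ≫ h = 𝟙 Y) : f = h := by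
  rw [← Category.comp_id f, ← e', ← Category.assoc, e, Category.id_comp]

theorem IsUnit.CC2 (hu : c.IsUnit I u) (X Y : M.Obj) :
    c.L X X Y ≫ c.pre (hu.j X) (c.H X Y) = hu.i.hom.app (c.H X Y) := by
  have key : (c.L X X Y ≫ c.pre (hu.j X) (c.H X Y)) ≫ c.undU u (c.H X Y) =
      𝟙 (c.H X Y) := by
    rw [comp_def, comp_def, ← app_undU, app_pre]
    unfold IsUnit.j
    rw [hu.post1_bar]
    apply InternalHoms.hom_ext
    refine (eq_of_heq (app_app_L' (M.id X) (c.one X))).trans ?_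
    exact congrArg (fun t : M.Hom [X] X => M.sub2 t (M.id (c.H X Y)) (c.ev1 X Y))
      (eq_of_heq (app_one (M.id X)))
  exact comp_inv_unique _ _ _ key (hu.undU_i (c.H X Y))

theorem CC3 (X Y U W : M.Obj) :
    c.L Y U W ≫ c.post (c.H Y U) (c.L X Y W) =
      c.L X U W ≫ c.L (c.H X Y) (c.H X U) (c.H X W) ≫
        c.pre (c.L X Y U) (c.H (c.H X Y) (c.H X W)) := by
  apply InternalHoms.hom_ext
  apply InternalHoms.hom_ext
  apply InternalHoms.hom_ext
  rw [← Category.assoc, comp_def, comp_def, comp_def, app_post, app_pre]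
  refine (eq_of_heq (app_app_L (M.id X) (M.id (c.H X Y))
    (M.sub2 (M.id (c.H Y U)) (c.L Y U W) (c.ev1 _ _)))).trans ?_
  refine (eq_of_heq (app_app_L' (M.sub2 (M.id X) (M.id (c.H X Y)) (c.ev1 X Y))
    (M.id (c.H Y U)))).trans ?_
  refine Eq.trans ?_ (congrArg
    (fun t : M.Hom [c.H X Y, c.H Y U, c.H U W] (c.H X W) => M.sub2 (M.id X) t (c.ev1 X W))
    (eq_of_heq (app_app_L (M.id (c.H X Y)) (M.post1 (M.id (c.H Y U)) (c.L X Y U))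
      (c.L X U W)))).symm
  refine Eq.trans ?_ (eq_of_heq (app_app_L' (M.id X) (M.sub2 (M.id (c.H X Y))
    (M.post1 (M.id (c.H Y U)) (c.L X Y U)) (c.ev1 _ _)))).symm
  exact congrArg (fun t : M.Hom [X, c.H X Y, c.H Y U] U => M.sub2 t (M.id (c.H U W)) (c.ev1 U W))
    (eq_of_heq (app_app_L (M.id X) (M.id (c.H X Y)) (M.id (c.H Y U)))).symm

theorem CC4_aux (u : M.Hom [] I) {Y Z : M.Obj} (iY : Y ⟶ c.H I Y) (iZ : Z ⟶ c.H I Z)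
    (hY : iY ≫ c.undU u Y = 𝟙 Y) (hZ : c.undU u Z ≫ iZ = 𝟙 (c.H I Z)) :
    c.L I Y Z ≫ c.pre iY (c.H I Z) = c.post Y iZ := by
  have e1 : c.post (c.H I Y) (c.undU u Z) ≫ c.post (c.H I Y) iZ =
      𝟙 (c.H (c.H I Y) (c.H I Z)) :=
    ((c.ihomFunctor.obj (op (c.H I Y))).map_comp (c.undU u Z) iZ).symm.trans
      ((congrArg _ hZ).trans ((c.ihomFunctor.obj (op (c.H I Y))).map_id (c.H I Z)))
  have e2 : c.pre (c.undU u Y) Z ≫ c.pre iY Z = 𝟙 (c.H Y Z) :=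
    (NatTrans.congr_app (c.ihomFunctor.map_comp (c.undU u Y).op iY.op) Z).symm.trans
      ((congrArg (fun t : Y ⟶ Y => (c.ihomFunctor.map t.op).app Z) hY).trans
        (NatTrans.congr_app (c.ihomFunctor.map_id (op Y)) Z))
  have e3 : c.pre iY Z ≫ c.post Y iZ = c.post (c.H I Y) iZ ≫ c.pre iY (c.H I Z) :=
    ((c.ihomFunctor.map iY.op).naturality iZ).symm
  calc c.L I Y Z ≫ c.pre iY (c.H I Z)
      = c.L I Y Z ≫ (c.post (c.H I Y) (c.undU u Z) ≫ c.post (c.H I Y) iZ) ≫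
          c.pre iY (c.H I Z) := by rw [e1, Category.id_comp]
    _ = (c.L I Y Z ≫ c.post (c.H I Y) (c.undU u Z)) ≫
          c.post (c.H I Y) iZ ≫ c.pre iY (c.H I Z) := by
        simp only [Category.assoc]
    _ = (c.pre (c.undU u Y) Z ≫ c.pre iY Z) ≫ c.post Y iZ := by
        rw [L_post_undU, ← e3, Category.assoc]
    _ = c.post Y iZ := by rw [e2, Category.id_comp]

theorem IsUnit.CC4 (hu : c.IsUnit I u) (Y Z : M.Obj) :
    c.L I Y Z ≫ c.pre (hu.i.hom.app Y) (c.H I Z) = c.post Y (hu.i.hom.app Z) :=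
  CC4_aux u (hu.i.hom.app Y) (hu.i.hom.app Z) (hu.i_undU Y) (hu.undU_i Z)

theorem IsUnit.γ_app (hu : c.IsUnit I u) {X Y : M.Obj} (f : X ⟶ Y) :
    M.sub2 (M.id X) (M.post1 u (hu.j X ≫ c.post X f)) (c.ev1 X Y) = f := by
  rw [comp_def, ← post1_assoc]
  unfold IsUnit.j
  rw [hu.post1_bar, app_post]
  refine (congrArg (fun t : M.Hom [X] X => M.post1 t f)
    (eq_of_heq (app_one (M.id X)))).trans ?_
  exact id_post1 f

theorem IsUnit.CC5 (hu : c.IsUnit I u) (X Y : M.Obj) :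
    Function.Bijective (fun f : X ⟶ Y => hu.j X ≫ c.post X f) := by
  have h1 := hu.bijective (c.H X Y)
  have h2 := c.bijective [X] Y []
  have h := h2.comp h1
  have e : ((fun f : M.Hom [] (c.ihom [X] Y) => M.phi [X] (c.ev [X] Y) f) ∘
      fun f : M.Hom [I] (c.H X Y) => M.post1 u f) ∘
      (fun f : X ⟶ Y => hu.j X ≫ c.post X f) = fun f => f := by
    funext f
    exact hu.γ_app f
  refine (Function.Bijective.of_comp_iff' h _).mp ?_
  rw [e]
  exact Function.bijective_id

/-- The underlying closed category of a closed multicategory `M` with chosen internal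
`Hom`-objects and with a unit object. -/
noncomputable def underlying (c : M.InternalHoms) {I : M.Obj} {u : M.Hom [] I}
    (hu : c.IsUnit I u) : ClosedCategory.{v, u} where
  carrier := M.Obj
  ihom := c.ihomFunctor
  unit := I
  i := hu.i
  j := hu.j
  L := c.L
  j_dinatural {X Y} f := by
    apply hu.hom_ext
    have h := one_pre (c := c) f
    rw [← hu.post1_bar (c.one X), ← hu.post1_bar (c.one Y), post1_assoc, post1_assoc] at h
    exact h.symm
  L_natural_left := L_natural_left
  L_natural_right := L_natural_right
  L_dinatural := L_dinatural
  CC1 := hu.CC1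
  CC2 := hu.CC2
  CC3 := CC3
  CC4 := hu.CC4
  CC5 := hu.CC5

end Multicategory.InternalHoms

/-! Everything rests on an enriched Yoneda lemma: for an enriched functor `G`, a transformation α :
L^K → G is determined by its element j_K · α_K : 1 → G K, and every such element occurs
(`elt_bijective`). Hence morphisms X₁, …, Xₙ → Y of the multicategory correspond to morphisms 1 →
[Xₙ, … [X₁, Y]] of C.

Closedness follows by taking H = [Xₘ, … [X₁, Z]], which is F Z for F = L^{Xₘ} ∘ … ∘ L^{X₁}, and
letting the evaluation be the action L^Z → L^{F Z} ∘ F of F on Hom-objects. Since F preserves j,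
evaluating f : Y₁, …, Yₙ → H does not change its element. Both sides of the required bijection are
therefore in bijection with the same set of elements, and the evaluation map becomes the identity
(`mapNat_hcomp_bijective`).

For units and for the underlying closed category only low arities matter. By Yoneda and CC5, a
nullary morphism () → Y is a morphism 1 → Y of C, a unary one A → Z is a morphism A → Z of C
(`ofUnary`), and a binary one A, B → Z is a morphism B → [A, Z] (`curry2`). An arbitrary choice ⟨X,
Z⟩ of internal Hom then represents the same functor as [X, Z], so currying its evaluation gives an
isomorphism ⟨X, Z⟩ → [X, Z] (`comparison`). Currying the equations that define the structure of the
underlying closed category shows that the comparison respects it; the essential case is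
`comparison_L`.

If u : () → I corresponds to t : 1 → I, then [u, 1] agrees with [t, 1] up to isomorphisms
(`isIso_mundU_iff`), so (I, u) is a unit exactly when t is invertible. Taking t = 1 gives the unit
of part 2; in part 3, t is the invertible unit constraint of the closed functor. -/

namespace ClosedCategory

/-! ### Consequences of the axioms of a closed category. -/

variable (C : ClosedCategory.{v, u})

/-- The components at the unit object of `i` and of `j` coincide. -/
theorem j_unit : C.j C.unit = C.i.hom.app C.unit := by
  -- Naturality of i at its own component i_1, which can then be cancelled.
  have h1 : C.i.hom.app (C.H C.unit C.unit) = C.post C.unit (C.i.hom.app C.unit) := by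
    have h := C.i.hom.naturality (C.i.hom.app C.unit)
    exact (cancel_epi (C.i.hom.app C.unit)).mp h
  apply C.γ_injective
  -- CC2, CC1 and dinaturality of j. With the previous identity, γ takes the same value on j_1 and
  -- on i_1.
  have h2 : C.j C.unit ≫ C.i.hom.app (C.H C.unit C.unit) = C.γ (C.j C.unit) := by
    rw [← C.CC2, reassoc_of% (C.CC1 C.unit C.unit), ← C.j_dinatural]
    rfl
  rw [← h2, h1]
  rfl

theorem inv_i_natural {X Y : C.carrier} (f : X ⟶ Y) :
    C.post C.unit f ≫ C.i.inv.app Y = C.i.inv.app X ≫ f :=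
  C.i.inv.naturality f

/-- This is CC4 with both occurrences of i moved across by their inverses. It supplies the last step
in the naturality of the transformation built from an element. -/
theorem L_unit_post_inv_i (Y Z : C.carrier) :
    C.L C.unit Y Z ≫ C.post (C.H C.unit Y) (C.i.inv.app Z) = C.pre (C.i.inv.app Y) Z := by
  have h1 : C.pre (C.i.inv.app Y) (C.H C.unit Z) ≫ C.pre (C.i.hom.app Y) (C.H C.unit Z) =
      𝟙 _ := by
    rw [← C.pre_comp]
    exact (congrArg (fun t => C.pre t _) (C.i.hom_inv_id_app Y)).trans (C.pre_id _ _)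
  have h1' : C.pre (C.i.hom.app Y) (C.H C.unit Z) ≫ C.pre (C.i.inv.app Y) (C.H C.unit Z) =
      𝟙 _ := by
    rw [← C.pre_comp]
    exact (congrArg (fun t => C.pre t _) (C.i.inv_hom_id_app Y)).trans (C.pre_id _ _)
  have h2 : C.L C.unit Y Z =
      C.post Y (C.i.hom.app Z) ≫ C.pre (C.i.inv.app Y) (C.H C.unit Z) := by
    rw [← C.CC4, Category.assoc, h1', Category.comp_id]
  have h3 : C.post Y (C.i.hom.app Z) ≫ C.post Y (C.i.inv.app Z) = 𝟙 _ := by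
    rw [← C.post_comp]
    exact (congrArg (fun t => C.post Y t) (C.i.hom_inv_id_app Z)).trans (C.post_id _ _)
  rw [h2, Category.assoc, C.pre_post]
  exact (Category.assoc _ _ _).symm.trans
    ((congrArg (fun t => t ≫ C.pre (C.i.inv.app Y) Z) h3).trans (Category.id_comp _))

theorem isIso_pre {X Y : C.carrier} (f : X ⟶ Y) [IsIso f] (Z : C.carrier) :
    IsIso (C.pre f Z) := by
  unfold HomCategory.pre
  infer_instance

/-- Under γ, precomposition with f turns into composition of elements 1 → [Y, Z] with [f, 1]. So f
induces bijections on Hom-sets into every Z, and the ordinary Yoneda argument applies. -/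
theorem isIso_of_isIso_pre {X Y : C.carrier} (f : X ⟶ Y)
    (h : ∀ Z : C.carrier, IsIso (C.pre f Z)) : IsIso f := by
  have hb : ∀ Z : C.carrier, Function.Bijective (fun g : Y ⟶ Z => f ≫ g) := by
    intro Z
    have h1 : Function.Bijective (fun t : C.unit ⟶ C.H Y Z => t ≫ C.pre f Z) := by
      have := h Z
      refine ⟨fun s t e => (cancel_mono (C.pre f Z)).mp e, fun t => ⟨t ≫ inv (C.pre f Z), ?_⟩⟩
      simp
    refine (Function.Bijective.of_comp_iff' (C.CC5 X Z) _).mp ?_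
    have e : (fun f => C.γ f) ∘ (fun g : Y ⟶ Z => f ≫ g) =
        (fun t : C.unit ⟶ C.H Y Z => t ≫ C.pre f Z) ∘ fun g => C.γ g := by
      funext g
      exact (C.γ_pre f g).symm
    rw [e]
    exact h1.comp (C.CC5 Y Z)
  obtain ⟨g, hg⟩ := (hb X).2 (𝟙 X)
  refine ⟨g, hg, (hb Y).1 ?_⟩
  simp only at hg ⊢
  rw [reassoc_of% hg, Category.comp_id]

end ClosedCategory

/-! ### The enriched Yoneda lemma and the bijection behind evaluation. -/

namespace VFunctor

variable {C : ClosedCategory.{v, u}}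

theorem L_map₀ (X : C.carrier) {Y Z : C.carrier} (f : Y ⟶ Z) :
    (VFunctor.L C.und X).map₀ f = C.post X f := by
  apply C.γ_injective
  rw [γ_map₀]
  exact C.γ_L X f

/-- The element `1 → G K` corresponding to `α : L^K → G` under the Yoneda bijection. -/
def elt {K : C.carrier} {G : VFunctor C.und C.und} (α : VFunctor.L C.und K ⟶ G) :
    C.unit ⟶ (G.obj K : C.carrier) :=
  C.j K ≫ VNatTrans.app α K

variable {K : C.carrier} {G : VFunctor C.und C.und}

/-- Naturality of α at K, precomposed with [j_K, 1], where CC2 turns L into i. The right side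
involves α only through its element and i is invertible, so the element determines α. -/
theorem app_i (α : VFunctor.L C.und K ⟶ G) (X : C.carrier) :
    VNatTrans.app α X ≫ C.i.hom.app (G.obj X) = G.map K X ≫ C.pre (elt α) (G.obj X) := by
  have h := VNatTrans.naturality α K X
  have hi : VNatTrans.app α X ≫ C.i.hom.app (G.obj X) =
      C.i.hom.app (C.H K X) ≫ C.post C.unit (VNatTrans.app α X) :=
    C.i.hom.naturality (VNatTrans.app α X)
  unfold elt
  rw [hi, C.pre_comp, ← Category.assoc (G.map K X), ← h, Category.assoc, ← C.pre_post,
    reassoc_of% (C.CC2 K X)]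

theorem elt_injective {α β : VFunctor.L C.und K ⟶ G} (h : elt α = elt β) : α = β := by
  apply hom_ext
  intro X
  apply (cancel_mono (C.i.hom.app (G.obj X))).mp
  exact (app_i α X).trans ((congrArg (fun t => G.map K X ≫ C.pre t (G.obj X)) h).trans
    (app_i β X).symm)

/-- The enriched natural transformation `L^K → G` corresponding to `t : 1 → G K`. -/
def ofElt (t : C.unit ⟶ (G.obj K : C.carrier)) : VFunctor.L C.und K ⟶ G where
  -- The formula of `app_i` solved for the component.
  app X := G.map K X ≫ C.pre t (G.obj X) ≫ C.i.inv.app (G.obj X)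
  naturality X Y := by
    -- The three factors are moved past L in turn: by the functor axiom of G, by dinaturality of L
    -- at t, and by the inverted form of CC4.
    change C.L K X Y ≫ C.post (C.H K X) (G.map K Y ≫ C.pre t (G.obj Y) ≫
      C.i.inv.app (G.obj Y)) = _
    rw [C.post_comp, C.post_comp, reassoc_of% (G.VF2 K X Y), C.pre_comp, C.pre_comp]
    rw [reassoc_of% (C.pre_post (G.map K X) (C.pre t (G.obj Y))), C.pre_post,
      reassoc_of% (C.L_dinatural t (G.obj X) (G.obj Y)), reassoc_of% C.pre_post,
      reassoc_of% (C.L_unit_post_inv_i (G.obj X) (G.obj Y)), Category.assoc]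
    rfl

theorem elt_ofElt (t : C.unit ⟶ (G.obj K : C.carrier)) : elt (ofElt t) = t := by
  have h : C.j K ≫ G.map K K = C.j (G.obj K) := G.VF1 K
  change C.j K ≫ G.map K K ≫ C.pre t (G.obj K) ≫ C.i.inv.app (G.obj K) = t
  -- Dinaturality and naturality extract t, leaving j_1 followed by the inverse of i_1; these cancel
  -- because j_1 = i_1.
  rw [reassoc_of% h, ← reassoc_of% (C.j_dinatural t), C.inv_i_natural, C.j_unit]
  exact (C.i.hom_inv_id_app_assoc C.unit t)

theorem elt_bijective : Function.Bijective (fun α : VFunctor.L C.und K ⟶ G => elt α) :=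
  ⟨fun _ _ h => elt_injective h, fun t => ⟨ofElt t, elt_ofElt t⟩⟩

/-- The enriched natural transformation `L^Z → L^{F Z} ∘ F` given by the action of `F` on
`Hom`-objects. -/
def mapNat (F : VFunctor C.und C.und) (Z : C.carrier) :
    VFunctor.L C.und Z ⟶ F.comp (VFunctor.L C.und (F.obj Z)) where
  app W := F.map Z W
  naturality X Y := by
    refine (F.VF2 Z X Y).trans ?_
    exact (Category.assoc _ _ _).symm

/-- At Z the composite is F_{Z,Z} followed by the component of f at F Z, and F carries j_Z to j_{F
Z}. -/
theorem elt_mapNat_hcomp (F : VFunctor C.und C.und) {Z : C.carrier}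
    (f : VFunctor.L C.und (F.obj Z) ⟶ G) : elt (mapNat F Z ≫ hcomp (𝟙 F) f) = elt f := by
  change C.j Z ≫ F.map Z Z ≫ (VFunctor.L C.und (F.obj Z)).map₀ (𝟙 _) ≫
    VNatTrans.app f (F.obj Z) = C.j (F.obj Z) ≫ VNatTrans.app f (F.obj Z)
  have h : C.j Z ≫ F.map Z Z = C.j (F.obj Z) := F.VF1 Z
  rw [map₀_id, reassoc_of% h]
  exact congrArg (fun t => C.j (F.obj Z) ≫ t) (Category.id_comp _)

/-- Source and target are both identified by Yoneda with the set of elements 1 → G F Z, and the map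
is compatible with these identifications. -/
theorem mapNat_hcomp_bijective (F G : VFunctor C.und C.und) (Z : C.carrier) :
    Function.Bijective (fun f : VFunctor.L C.und (F.obj Z) ⟶ G =>
      mapNat F Z ≫ hcomp (𝟙 F) f) := by
  refine (Function.Bijective.of_comp_iff'
    (elt_bijective (K := Z) (G := F.comp G)) _).mp ?_
  have e : (fun α : VFunctor.L C.und Z ⟶ F.comp G => elt α) ∘
      (fun f : VFunctor.L C.und (F.obj Z) ⟶ G => mapNat F Z ≫ hcomp (𝟙 F) f) =
      fun f => elt f := by
    funext f
    exact elt_mapNat_hcomp F f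
  rw [e]
  exact elt_bijective

end VFunctor

/-! ### Closedness of the associated multicategory. -/

namespace ClosedCategory

variable (C : ClosedCategory.{v, u})

/-- Makes the horizontal composites of a concatenation and of identities applicable to the family
(1, …, 1, f). -/
theorem idsAppend_eq (Xs : List C.carrier) {As : List (List C.carrier)} {Bs : List C.carrier}
    (fs : Fam C.multigraph.Hom As Bs) :
    C.premulticategory.idsAppend Xs fs = (C.premulticategory.ids Xs).append fs := by
  induction Xs with
  | nil => rfl
  | cons X Xs ih => exact congrArg (Fam.cons _) ih

theorem castHom_eq {Xs Ys : List C.carrier} {Z : C.carrier} (e : Xs = Ys)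
    (f : VFunctor.L C.und Z ⟶ C.LL Xs) :
    (C.multicategory.castHom e f : VFunctor.L C.und Z ⟶ C.LL Ys) =
      f ≫ eqToHom (congrArg C.LL e) := by
  subst e
  exact (Category.comp_id f).symm

theorem LL_singleton (X : C.carrier) : C.LL [X] = VFunctor.L C.und X :=
  VFunctor.comp_id (VFunctor.L C.und X)

theorem hcompFam_singleton {Ys : List C.carrier} {H : C.carrier}
    (f : VFunctor.L C.und H ⟶ C.LL Ys) :
    C.hcompFam (Fam.cons f Fam.nil : Fam C.multigraph.Hom [Ys] [H]) =
      eqToHom (C.LL_singleton H) ≫ f ≫ eqToHom (congrArg C.LL (by simp)) := by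
  change VFunctor.hcomp (F := VFunctor.L C.und H) (F' := C.LL Ys) f
    (𝟙 (VFunctor.id C.und)) ≫ eqToHom _ = _
  rw [VFunctor.hcomp_id_right]
  simp only [Category.assoc]
  erw [eqToHom_trans]
  rfl

/-- The evaluation `X₁, …, Xₘ, H → Z` for `H = L^{Xₘ} … L^{X₁} Z`. -/
def evLL (Xs : List C.carrier) (Z : C.carrier) :
    VFunctor.L C.und Z ⟶ C.LL (Xs ++ [((C.LL Xs).obj Z : C.carrier)]) :=
  VFunctor.mapNat (C.LL Xs) Z ≫ eqToHom (by rw [LL_append, LL_singleton])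

/-- The horizontal composite of (1, …, 1, f) is f whiskered with `LL Xs`, up to transport along
equalities of functors; all the transports merge into one. -/
theorem phi_evLL (Xs Ys : List C.carrier) (Z : C.carrier)
    (f : VFunctor.L C.und ((C.LL Xs).obj Z) ⟶ C.LL Ys) :
    (C.multicategory.phi Xs (C.evLL Xs Z) f : VFunctor.L C.und Z ⟶ C.LL (Xs ++ Ys)) =
      (VFunctor.mapNat (C.LL Xs) Z ≫ VFunctor.hcomp (𝟙 (C.LL Xs)) f) ≫
        eqToHom (C.LL_append Xs Ys).symm := by
  refine (C.castHom_eq _ _).trans ?_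
  change (C.evLL Xs Z ≫ C.hcompFam (C.premulticategory.idsAppend Xs
    (Fam.cons f Fam.nil : Fam C.multigraph.Hom [Ys] [((C.LL Xs).obj Z : C.carrier)]))) ≫ _ = _
  rw [idsAppend_eq, hcompFam_append, hcompFam_ids, hcompFam_singleton]
  -- Stated for arbitrary functors, so that the equalities can be eliminated by substitution.
  have e : ∀ {F F' G₁ G G' G₂ : VFunctor C.und C.und} (h : F = F') (h₁ : G₁ = G)
      (β : G ⟶ G') (h₂ : G' = G₂),
      VFunctor.hcomp (eqToHom h) (eqToHom h₁ ≫ β ≫ eqToHom h₂) =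
        eqToHom (by rw [h₁]) ≫ VFunctor.hcomp (𝟙 F) β ≫ eqToHom (by rw [h₂, h]) := by
    intro F F' G₁ G G' G₂ h h₁ β h₂
    subst h
    subst h₁
    subst h₂
    simp
  rw [e]
  simp only [evLL, Category.assoc, eqToHom_trans, eqToHom_trans_assoc, eqToHom_refl,
    Category.id_comp]
  refine (Category.assoc _ _ _).trans (congrArg (fun t => VFunctor.mapNat (C.LL Xs) Z ≫ t) ?_)
  refine (Category.assoc _ _ _).trans (congrArg (fun t => VFunctor.hcomp _ f ≫ t) ?_)
  exact eqToHom_trans _ _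

theorem comp_eqToHom_bijective {K : Type u₁} [Category.{v₁} K] {X Y Z : K} (h : Y = Z) :
    Function.Bijective (fun g : X ⟶ Y => g ≫ eqToHom h) := by
  subst h
  simp only [eqToHom_refl, Category.comp_id]
  exact Function.bijective_id

theorem multicategory_isClosed : C.multicategory.IsClosed := by
  intro Xs Z
  -- The internal Hom is the iterated one, [Xₘ, … [X₁, Z]].
  refine ⟨((C.LL Xs).obj Z : C.carrier), C.evLL Xs Z, fun Ys => ?_⟩
  have e : (fun f : C.multicategory.Hom Ys ((C.LL Xs).obj Z : C.carrier) =>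
      C.multicategory.phi Xs (C.evLL Xs Z) f) =
      (fun g : VFunctor.L C.und Z ⟶ (C.LL Xs).comp (C.LL Ys) =>
        g ≫ eqToHom (C.LL_append Xs Ys).symm) ∘
      (fun f : VFunctor.L C.und ((C.LL Xs).obj Z) ⟶ C.LL Ys =>
        VFunctor.mapNat (C.LL Xs) Z ≫ VFunctor.hcomp (𝟙 (C.LL Xs)) f) :=
    funext fun f => C.phi_evLL Xs Ys Z f
  rw [e]
  refine Function.Bijective.comp ?_ (VFunctor.mapNat_hcomp_bijective _ _ _)
  exact comp_eqToHom_bijective _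

/-! ### Multimorphisms read in C through components, elements and currying. -/

/-- Morphisms `X₁, …, Xₙ → Y` of the multicategory associated with `C`. -/
abbrev MHom (Xs : List C.carrier) (Y : C.carrier) : Type (max u v) :=
  VFunctor.L C.und Y ⟶ C.LL Xs

/-- The operation `Multicategory.castHom` for the multicategory associated with `C`. -/
noncomputable def mcastHom {Xs Ys : List C.carrier} {Z : C.carrier} (e : Xs = Ys) (f : C.MHom Xs Z) :
    C.MHom Ys Z :=
  C.multicategory.castHom e f

/-- The operation `Multicategory.post1` for the multicategory associated with `C`. -/
noncomputable def mpost1 {Xs : List C.carrier} {Y Z : C.carrier} (f : C.MHom Xs Y)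
    (g : C.MHom [Y] Z) : C.MHom Xs Z :=
  C.multicategory.post1 f g

/-- The operation `Multicategory.sub2` for the multicategory associated with `C`. -/
noncomputable def msub2 {Γ Δ : List C.carrier} {A B Z : C.carrier} (f : C.MHom Γ A)
    (g : C.MHom Δ B) (k : C.MHom [A, B] Z) : C.MHom (Γ ++ Δ) Z :=
  C.multicategory.sub2 f g k

/-- The identities of the multicategory associated with `C`. -/
noncomputable def mid (X : C.carrier) : C.MHom [X] X :=
  C.multicategory.id X

/-- The component at `W` of a morphism of the multicategory associated with `C`. -/
def component {Xs : List C.carrier} {Y : C.carrier} (f : C.MHom Xs Y)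
    (W : C.carrier) : C.H Y W ⟶ ((C.LL Xs).obj W : C.carrier) :=
  VNatTrans.app (F := VFunctor.L C.und Y) (G := C.LL Xs) f W

/-- The element `1 → [Xₙ, … [X₁, Y]]` corresponding to a morphism `X₁, …, Xₙ → Y`. -/
def element {Xs : List C.carrier} {Y : C.carrier} (f : C.MHom Xs Y) :
    C.unit ⟶ ((C.LL Xs).obj Y : C.carrier) :=
  C.j Y ≫ C.component f Y

theorem element_bijective (Xs : List C.carrier) (Y : C.carrier) :
    Function.Bijective (fun f : C.MHom Xs Y => C.element f) :=
  VFunctor.elt_bijective (K := Y) (G := C.LL Xs)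

/-- Naturality of f at g, evaluated on j_Y. As every element of [Y, Z] is some γ g, this computes
components of f on elements. -/
theorem γ_component {Xs : List C.carrier} {Y Z : C.carrier} (f : C.MHom Xs Y)
    (g : Y ⟶ Z) : C.γ g ≫ C.component f Z = C.element f ≫ (C.LL Xs).map₀ g := by
  have h := VFunctor.app_naturality (G := VFunctor.L C.und Y) (G' := C.LL Xs) f g
  rw [VFunctor.L_map₀] at h
  unfold element
  rw [Category.assoc]
  exact (Category.assoc _ _ _).trans (congrArg (fun t => C.j Y ≫ t) h)

theorem component_i {Xs : List C.carrier} {Y : C.carrier} (f : C.MHom Xs Y)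
    (W : C.carrier) : C.component f W ≫ C.i.hom.app ((C.LL Xs).obj W) =
      (C.LL Xs).map Y W ≫ C.pre (C.element f) ((C.LL Xs).obj W) :=
  VFunctor.app_i (K := Y) (G := C.LL Xs) f W

/-- Since i is invertible, a component can be recognised after composing with i, where only the
element of f is left. The explicit components in arities one and two are found this way. -/
theorem component_eq_of_element {Xs : List C.carrier} {Y : C.carrier}
    (f : C.MHom Xs Y) (W : C.carrier) (t : C.H Y W ⟶ ((C.LL Xs).obj W : C.carrier))
    (h : t ≫ C.i.hom.app ((C.LL Xs).obj W) =
      (C.LL Xs).map Y W ≫ C.pre (C.element f) ((C.LL Xs).obj W)) : C.component f W = t :=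
  (cancel_mono (C.i.hom.app ((C.LL Xs).obj W))).mp ((C.component_i f W).trans h.symm)

theorem component_castHom {Xs Ys : List C.carrier} {Z : C.carrier} (e : Xs = Ys)
    (f : C.MHom Xs Z) (W : C.carrier) :
    C.component (C.mcastHom e f) W =
      C.component f W ≫ eqToHom (by rw [e]) := by
  subst e
  exact (Category.comp_id _).symm

theorem LL_append_obj (Xs Ys : List C.carrier) (W : C.carrier) :
    ((C.LL Ys).obj ((C.LL Xs).obj W) : C.carrier) = (C.LL (Xs ++ Ys)).obj W := by
  rw [LL_append]

theorem LL_singleton_map₀ (B : C.carrier) {X Y : C.carrier} (f : X ⟶ Y) :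
    (C.LL [B]).map₀ f = C.post B f := by
  -- `LL [B]` is L^B followed by the identity functor, equal to L^B only propositionally; hence the
  -- detour through an arbitrary F.
  have e : ∀ (F : VFunctor C.und C.und), F = VFunctor.L C.und B →
      HEq (F.map₀ f) (C.post B f) := by
    rintro F rfl
    exact heq_of_eq (VFunctor.L_map₀ B f)
  exact eq_of_heq (e _ (C.LL_singleton B))

theorem LL_pair_map₀ (A B : C.carrier) {X Y : C.carrier} (f : X ⟶ Y) :
    (C.LL [A, B]).map₀ f = C.post B (C.post A f) := by
  change ((VFunctor.L C.und A).comp (C.LL [B])).map₀ _ = _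
  rw [VFunctor.comp_map₀, VFunctor.L_map₀]
  exact C.LL_singleton_map₀ B _

theorem hcompFam_singleton_app {Ys : List C.carrier} {H : C.carrier}
    (f : VFunctor.L C.und H ⟶ C.LL Ys) (W : C.carrier) :
    (VNatTrans.app (C.hcompFam (Fam.cons f Fam.nil : Fam C.multigraph.Hom [Ys] [H])) W :
      C.H H W ⟶ ((C.LL [Ys].flatten).obj W : C.carrier)) =
      VNatTrans.app f W ≫ eqToHom (C.LL_append_obj Ys [] W) := by
  rw [C.hcompFam_singleton f, VFunctor.category_comp_app, VFunctor.category_comp_app,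
    VFunctor.eqToHom_app', VFunctor.eqToHom_app']
  exact Category.id_comp _

theorem hcompFam_pair_app {Γ Δ : List C.carrier} {A B : C.carrier}
    (f : VFunctor.L C.und A ⟶ C.LL Γ) (g : VFunctor.L C.und B ⟶ C.LL Δ) (W : C.carrier) :
    (VNatTrans.app (C.hcompFam (Fam.cons f (Fam.cons g Fam.nil) :
      Fam C.multigraph.Hom [Γ, Δ] [A, B])) W :
      C.H B (C.H A W) ⟶ ((C.LL [Γ, Δ].flatten).obj W : C.carrier)) =
      C.post B (VNatTrans.app f W) ≫ VNatTrans.app g ((C.LL Γ).obj W) ≫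
        eqToHom ((C.LL_append_obj Δ [] _).trans (C.LL_append_obj Γ (Δ ++ []) W)) := by
  change VNatTrans.app (VFunctor.hcomp (F := VFunctor.L C.und A) (F' := C.LL Γ) f
    (C.hcompFam (Fam.cons g Fam.nil : Fam C.multigraph.Hom [Δ] [B])) ≫
      eqToHom (C.LL_append Γ [Δ].flatten).symm) W = _
  rw [VFunctor.category_comp_app, VFunctor.hcomp_app, VFunctor.eqToHom_app',
    hcompFam_singleton_app]
  erw [LL_singleton_map₀]
  refine (Category.assoc _ _ _).trans (congrArg (fun t => C.post B (VNatTrans.app f W) ≫ t) ?_)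
  refine (Category.assoc _ _ _).trans
    (congrArg (fun t => VNatTrans.app g ((C.LL Γ).obj W) ≫ t) ?_)
  exact eqToHom_trans _ _

theorem comp_eqToHom_eqToHom {K : Type u₁} [Category.{v₁} K] {X Y Z : K} (f : X ⟶ Y)
    (h : Y = Z) (h' : Z = Y) : (f ≫ eqToHom h) ≫ eqToHom h' = f := by
  simp

/-- The order is reversed because a morphism into Y is a transformation out of L^Y. The
contravariance of L^Y in Y reverses it again, so `ofUnary` is covariant. -/
theorem component_post1 {Xs : List C.carrier} {Y Z : C.carrier}
    (f : C.MHom Xs Y) (g : C.MHom [Y] Z) (W : C.carrier) :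
    C.component (C.mpost1 f g) W =
      C.component g W ≫ C.component f W := by
  refine (C.component_castHom _ _ _).trans ?_
  change (VNatTrans.app g W ≫ VNatTrans.app (C.hcompFam
    (Fam.cons f Fam.nil : Fam C.multigraph.Hom [Xs] [Y])) W) ≫ _ = _
  refine (Category.assoc _ _ _).trans (congrArg (fun t => C.component g W ≫ t) ?_)
  refine (congrArg (fun t => t ≫ eqToHom _) (C.hcompFam_singleton_app f W)).trans ?_
  exact comp_eqToHom_eqToHom _ _ _

theorem component_sub2 {Γ Δ : List C.carrier} {A B Z : C.carrier}
    (f : C.MHom Γ A) (g : C.MHom Δ B)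
    (k : C.MHom [A, B] Z) (W : C.carrier) :
    C.component (C.msub2 f g k) W =
      C.component k W ≫ C.post B (C.component f W) ≫
        C.component g ((C.LL Γ).obj W : C.carrier) ≫ eqToHom (C.LL_append_obj Γ Δ W) := by
  refine (C.component_castHom _ _ _).trans ?_
  change (VNatTrans.app k W ≫ VNatTrans.app (C.hcompFam (Fam.cons f (Fam.cons g Fam.nil) :
      Fam C.multigraph.Hom [Γ, Δ] [A, B])) W) ≫ _ = _
  refine (Category.assoc _ _ _).trans (congrArg (fun t => C.component k W ≫ t) ?_)
  refine (congrArg (fun t => t ≫ eqToHom _) (C.hcompFam_pair_app f g W)).trans ?_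
  refine (Category.assoc _ _ _).trans (congrArg (fun t => C.post B (C.component f W) ≫ t) ?_)
  refine (Category.assoc _ _ _).trans
    (congrArg (fun t => C.component g ((C.LL Γ).obj W) ≫ t) ?_)
  exact eqToHom_trans _ _

theorem element_post1 {Xs : List C.carrier} {Y Z : C.carrier}
    (f : C.MHom Xs Y) (g : C.MHom [Y] Z) :
    C.element (C.mpost1 f g) = C.element g ≫ C.component f Z := by
  unfold element
  rw [component_post1]
  exact (Category.assoc _ _ _).symm

theorem element_sub2 {Γ Δ : List C.carrier} {A B Z : C.carrier}
    (f : C.MHom Γ A) (g : C.MHom Δ B)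
    (k : C.MHom [A, B] Z) :
    C.element (C.msub2 f g k) =
      C.element k ≫ C.post B (C.component f Z) ≫
        C.component g ((C.LL Γ).obj Z : C.carrier) ≫ eqToHom (C.LL_append_obj Γ Δ Z) := by
  unfold element
  rw [component_sub2]
  exact (Category.assoc _ _ _).symm

/-- The morphism `B → [A, Z]` corresponding to a morphism `A, B → Z`. -/
noncomputable def curry2 {A B Z : C.carrier} (k : C.MHom [A, B] Z) :
    B ⟶ C.H A Z :=
  -- `LL [A, B]` sends Z to [B, [A, Z]], so CC5 turns the element into a morphism out of B.
  ((C.CC5 B (C.H A Z)).2 (C.element k)).choose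

theorem γ_curry2 {A B Z : C.carrier} (k : C.MHom [A, B] Z) :
    C.γ (C.curry2 k) = C.element k :=
  ((C.CC5 B (C.H A Z)).2 (C.element k)).choose_spec

/-- The morphism `A → Z` of `C` corresponding to a unary morphism of the multicategory. -/
noncomputable def ofUnary {A Z : C.carrier} (k : C.MHom [A] Z) : A ⟶ Z :=
  ((C.CC5 A Z).2 (C.element k)).choose

theorem γ_ofUnary {A Z : C.carrier} (k : C.MHom [A] Z) :
    C.γ (C.ofUnary k) = C.element k :=
  ((C.CC5 A Z).2 (C.element k)).choose_spec

theorem ofUnary_bijective (A Z : C.carrier) :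
    Function.Bijective (fun k : C.MHom [A] Z => C.ofUnary k) := by
  refine (Function.Bijective.of_comp_iff' (C.CC5 A Z) _).mp ?_
  have e : (fun f => C.γ f) ∘ (fun k : C.MHom [A] Z => C.ofUnary k) =
      fun k => C.element k := funext C.γ_ofUnary
  rw [e]
  exact C.element_bijective [A] Z

/-- The element is γ of the corresponding morphism, and naturality of L together with CC2
(`L_pre_γ`) evaluates L on it. -/
theorem component_unary {A Z : C.carrier} (k : C.MHom [A] Z) (W : C.carrier) :
    C.component k W = C.pre (C.ofUnary k) W := by
  apply component_eq_of_element
  rw [← γ_ofUnary]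
  refine (C.L_pre_γ (C.ofUnary k) W).symm.trans ?_
  exact congrArg (fun t => t ≫ C.pre (C.γ (C.ofUnary k)) (C.H A W))
    (Category.comp_id (C.L A Z W)).symm

theorem ofUnary_id (A : C.carrier) : C.ofUnary (C.mid A) = 𝟙 A := by
  apply C.γ_injective
  rw [γ_ofUnary, C.γ_id]
  change C.j A ≫ VNatTrans.app (eqToHom (VFunctor.comp_id (VFunctor.L C.und A)).symm) A = _
  rw [VFunctor.eqToHom_app']
  exact Category.comp_id _

theorem ofUnary_post1 {A B Z : C.carrier} (f : C.MHom [A] B)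
    (g : C.MHom [B] Z) :
    C.ofUnary (C.mpost1 f g) = C.ofUnary f ≫ C.ofUnary g := by
  apply C.γ_injective
  rw [γ_ofUnary, element_post1, component_unary, ← γ_ofUnary]
  exact C.γ_pre _ _

theorem component_nullary_natural {Y Z : C.carrier} (f : C.MHom [] Y) (g : Y ⟶ Z) :
    C.γ g ≫ C.component f Z = C.element f ≫ g := by
  rw [γ_component]
  exact congrArg (fun t => C.element f ≫ t) (VFunctor.id_map₀ g)

/-- Here `LL []` is the identity functor. This turns the unit condition on () → Y into a condition
on its element. -/
theorem component_nullary_i {Y : C.carrier} (f : C.MHom [] Y) (Z : C.carrier) :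
    C.component f Z ≫ C.i.hom.app Z = C.pre (C.element f) Z :=
  (C.component_i f Z).trans (Category.id_comp _)

theorem element_post1_nullary {Y Z : C.carrier} (f : C.MHom [] Y)
    (g : C.MHom [Y] Z) :
    C.element (C.mpost1 f g) = C.element f ≫ C.ofUnary g := by
  rw [element_post1, ← γ_ofUnary]
  exact C.component_nullary_natural f _

/-- `LL [A, B]` acts on Hom-objects by two successive instances of L; the outer one is absorbed by
`L_pre_γ`. Through this formula L enters the comparison of composition laws. -/
theorem component_binary {A B Z : C.carrier} (k : C.MHom [A, B] Z)
    (W : C.carrier) :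
    C.component k W = C.L A Z W ≫ C.pre (C.curry2 k) (C.H A W) := by
  apply component_eq_of_element
  rw [← γ_curry2]
  have e : (C.LL [A, B]).map Z W = C.L A Z W ≫ C.L B (C.H A Z) (C.H A W) :=
    congrArg (fun t => C.L A Z W ≫ t) (Category.comp_id (C.L B (C.H A Z) (C.H A W)))
  rw [e]
  change (C.L A Z W ≫ C.pre (C.curry2 k) (C.H A W)) ≫ C.i.hom.app (C.H B (C.H A W)) =
    (C.L A Z W ≫ C.L B (C.H A Z) (C.H A W)) ≫ C.pre (C.γ (C.curry2 k)) (C.H B (C.H A W))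
  rw [Category.assoc, Category.assoc, C.L_pre_γ]

/-- In the formula for the element of a substitution, unary components are of the form [–, 1], which
`γ_post` and `γ_pre` absorb into the argument of γ. The other substitution formulas follow the same
pattern. -/
theorem curry2_sub2 {A A' B B' Z : C.carrier} (f : C.MHom [A'] A)
    (g : C.MHom [B'] B) (k : C.MHom [A, B] Z) :
    C.curry2 (C.msub2 f g k) =
      C.ofUnary g ≫ C.curry2 k ≫ C.pre (C.ofUnary f) Z := by
  apply C.γ_injective
  rw [γ_curry2, element_sub2, component_unary, component_unary, ← γ_curry2, ← C.γ_pre,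
    ← C.γ_post, Category.assoc]
  exact congrArg (fun t => C.γ (C.curry2 k) ≫ C.post B (C.pre (C.ofUnary f) Z) ≫ t)
    (Category.comp_id (C.pre (C.ofUnary g) (C.H A' Z)))

theorem curry2_post1 {A B Z W : C.carrier} (k : C.MHom [A, B] Z)
    (g : C.MHom [Z] W) :
    C.curry2 (C.mpost1 k g) = C.curry2 k ≫ C.post A (C.ofUnary g) := by
  apply C.γ_injective
  rw [γ_curry2, element_post1, ← γ_ofUnary, ← C.γ_post, γ_curry2]
  refine (C.γ_component k (C.ofUnary g)).trans ?_
  exact congrArg (fun t => C.element k ≫ t) (C.LL_pair_map₀ A B _)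

theorem element_sub2_unary_nullary {A A' B Z : C.carrier} (f : C.MHom [A'] A)
    (g : C.MHom [] B) (k : C.MHom [A, B] Z) :
    C.element (C.msub2 f g k) =
      C.element g ≫ C.curry2 k ≫ C.pre (C.ofUnary f) Z := by
  rw [element_sub2, component_unary, ← γ_curry2]
  refine (congrArg (fun t => C.γ (C.curry2 k) ≫ C.post B (C.pre (C.ofUnary f) Z) ≫ t)
    (Category.comp_id (C.component g (C.H A' Z)))).trans ?_
  refine Eq.trans ?_ (C.component_nullary_natural g (C.curry2 k ≫ C.pre (C.ofUnary f) Z))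
  rw [← C.γ_post]
  exact (Category.assoc _ _ _).symm

theorem ofUnary_sub2_nullary_unary {A B B' Z : C.carrier} (f : C.MHom [] A)
    (g : C.MHom [B'] B) (k : C.MHom [A, B] Z) :
    C.ofUnary (C.msub2 f g k) =
      C.ofUnary g ≫ C.curry2 k ≫ C.component f Z := by
  apply C.γ_injective
  rw [γ_ofUnary, element_sub2, component_unary, ← γ_curry2]
  refine (congrArg (fun t => C.γ (C.curry2 k) ≫ C.post B (C.component f Z) ≫ t)
    (Category.comp_id (C.pre (C.ofUnary g) Z))).trans ?_
  refine (Category.assoc _ _ _).symm.trans ?_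
  refine (congrArg (fun t => t ≫ C.pre (C.ofUnary g) Z)
    (C.γ_post (C.curry2 k) (C.component f Z))).trans ?_
  exact C.γ_pre (C.ofUnary g) (C.curry2 k ≫ C.component f Z)

/-- Meant for (1, μ) · ev. The result is expressed as a value of γ so that it can be compared with
(ev, 1) · ev by injectivity of γ. -/
theorem element_sub2_unary_binary {A A' B P Q Z : C.carrier} (f : C.MHom [A'] A)
    (g : C.MHom [P, Q] B) (k : C.MHom [A, B] Z) :
    C.element (C.msub2 f g k) =
      C.γ (C.curry2 g ≫ C.post P (C.curry2 k ≫ C.pre (C.ofUnary f) Z)) := by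
  rw [element_sub2, component_unary, ← γ_curry2]
  refine (congrArg (fun t => C.γ (C.curry2 k) ≫ C.post B (C.pre (C.ofUnary f) Z) ≫ t)
    (Category.comp_id (C.component g (C.H A' Z)))).trans ?_
  rw [← C.γ_post, γ_curry2 C g]
  refine Eq.trans ?_ (congrArg (fun t => C.element g ≫ t) (C.LL_pair_map₀ P Q _))
  refine Eq.trans ?_ (C.γ_component g (C.curry2 k ≫ C.pre (C.ofUnary f) Z))
  rw [← C.γ_post]
  exact (Category.assoc _ _ _).symm

/-- The counterpart for (ev, 1) · ev. -/
theorem element_sub2_binary_unary {A B P Q Q' Z : C.carrier} (f : C.MHom [A, P] B)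
    (g : C.MHom [Q'] Q) (k : C.MHom [B, Q] Z) :
    C.element (C.msub2 f g k) =
      C.γ (C.ofUnary g ≫ C.curry2 k ≫ C.component f Z) := by
  rw [element_sub2, component_unary, ← γ_curry2]
  refine (congrArg (fun t => C.γ (C.curry2 k) ≫ C.post Q (C.component f Z) ≫ t)
    (Category.comp_id (C.pre (C.ofUnary g) (C.H P (C.H A Z))))).trans ?_
  refine (Category.assoc _ _ _).symm.trans ?_
  refine (congrArg (fun t => t ≫ C.pre (C.ofUnary g) (C.H P (C.H A Z)))
    (C.γ_post (C.curry2 k) (C.component f Z))).trans ?_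
  exact C.γ_pre (C.ofUnary g) (C.curry2 k ≫ C.component f Z)

end ClosedCategory

/-! ### Comparison of chosen internal Hom-objects with those of C. -/

namespace ClosedCategory

variable {C : ClosedCategory.{v, u}} (c : C.multicategory.InternalHoms)

/-- The chosen internal `Hom`-object as an object of `C`. -/
noncomputable def mH (X Z : C.carrier) : C.carrier := c.H X Z

/-- The evaluation `X, ⟨X, Z⟩ → Z`. -/
noncomputable def mev (X Z : C.carrier) : C.MHom [X, mH c X Z] Z := c.ev1 X Z

/-- The composition `⟨X, Y⟩, ⟨Y, Z⟩ → ⟨X, Z⟩`. -/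
noncomputable def mmu (X Y Z : C.carrier) : C.MHom [mH c X Y, mH c Y Z] (mH c X Z) :=
  c.mu X Y Z

/-- The morphism `⟨Y, Z⟩ → ⟨⟨X, Y⟩, ⟨X, Z⟩⟩`. -/
noncomputable def mL (X Y Z : C.carrier) :
    C.MHom [mH c Y Z] (mH c (mH c X Y) (mH c X Z)) :=
  c.L X Y Z

/-- The morphism `() → ⟨X, X⟩` corresponding to the identity of `X`. -/
noncomputable def mone (X : C.carrier) : C.MHom [] (mH c X X) := c.one X

/-- The morphism `⟨f, 1⟩`. -/
noncomputable def mpre {X X' : C.carrier} (f : C.MHom [X] X') (Z : C.carrier) :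
    C.MHom [mH c X' Z] (mH c X Z) :=
  c.pre (X := X) (X' := X') f Z

/-- The morphism `⟨1, g⟩`. -/
noncomputable def mpost (X : C.carrier) {Z Z' : C.carrier} (g : C.MHom [Z] Z') :
    C.MHom [mH c X Z] (mH c X Z') :=
  c.post X (Z := Z) (Z' := Z') g

/-- The morphism `⟨I, X⟩ → X` induced by `u : () → I`. -/
noncomputable def mundU {I : C.carrier} (u : C.MHom [] I) (X : C.carrier) :
    C.MHom [mH c I X] X :=
  c.undU u X

/-- The comparison `⟨X, Z⟩ → [X, Z]` of the chosen internal `Hom`-object with that of `C`. -/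
noncomputable def comparison (X Z : C.carrier) : mH c X Z ⟶ C.H X Z :=
  C.curry2 (mev c X Z)

/-- Evaluation of a unary g becomes composition with the comparison, so each equation defining a
morphism into ⟨X, Z⟩ through ev becomes an equation in C. -/
theorem curry2_id_ev {X Z B : C.carrier} (g : C.MHom [B] (mH c X Z)) :
    C.curry2 (C.msub2 (C.mid X) g (mev c X Z)) = C.ofUnary g ≫ comparison c X Z := by
  rw [curry2_sub2, ofUnary_id, C.pre_id, Category.comp_id]
  rfl

/-- The universal property of ⟨X, Z⟩ on one-term sources B says, after currying, that composing with
the comparison is a bijection C(B, ⟨X, Z⟩) → C(B, [X, Z]) for every B. -/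
theorem isIso_comparison (X Z : C.carrier) : IsIso (comparison c X Z) := by
  have hb : ∀ B : C.carrier, Function.Bijective
      (fun t : B ⟶ mH c X Z => t ≫ comparison c X Z) := by
    intro B
    have h1 : Function.Bijective (fun k : C.MHom [X, B] Z => C.curry2 k) := by
      refine (Function.Bijective.of_comp_iff' (C.CC5 B (C.H X Z)) _).mp ?_
      have e : (fun f => C.γ f) ∘ (fun k : C.MHom [X, B] Z => C.curry2 k) =
          fun k => C.element k := funext C.γ_curry2
      rw [e]
      exact C.element_bijective [X, B] Z
    have h2 : Function.Bijective (fun g : C.MHom [B] (mH c X Z) =>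
        C.msub2 (C.mid X) g (mev c X Z)) := c.bijective [X] Z [B]
    refine (Function.Bijective.of_comp_iff _ (C.ofUnary_bijective B (mH c X Z))).mp ?_
    have e : (fun t : B ⟶ mH c X Z => t ≫ comparison c X Z) ∘
        (fun k : C.MHom [B] (mH c X Z) => C.ofUnary k) =
        (fun k : C.MHom [X, B] Z => C.curry2 k) ∘ (fun g : C.MHom [B] (mH c X Z) =>
        C.msub2 (C.mid X) g (mev c X Z)) := funext fun g => (curry2_id_ev c g).symm
    rw [e]
    exact h1.comp h2
  obtain ⟨g, hg⟩ := (hb (C.H X Z)).2 (𝟙 _)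
  -- The preimage of the identity is a section; injectivity of composition with the comparison makes
  -- it two-sided.
  refine ⟨g, (hb _).1 ?_, hg⟩
  simp only at hg ⊢
  rw [Category.assoc, hg, Category.comp_id, Category.id_comp]

theorem comparison_pre {X X' : C.carrier} (f : C.MHom [X] X') (Z : C.carrier) :
    C.ofUnary (mpre c f Z) ≫ comparison c X Z =
      comparison c X' Z ≫ C.pre (C.ofUnary f) Z := by
  rw [← curry2_id_ev]
  have h : C.msub2 (C.mid X) (mpre c f Z) (mev c X Z) =
      C.msub2 f (C.mid (mH c X' Z)) (mev c X' Z) :=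
    Multicategory.InternalHoms.sub2_lam (c := c) _
  rw [h, curry2_sub2, ofUnary_id, Category.id_comp]
  rfl

theorem comparison_post (X : C.carrier) {Z Z' : C.carrier} (g : C.MHom [Z] Z') :
    C.ofUnary (mpost c X g) ≫ comparison c X Z' =
      comparison c X Z ≫ C.post X (C.ofUnary g) := by
  rw [← curry2_id_ev]
  have h : C.msub2 (C.mid X) (mpost c X g) (mev c X Z') = C.mpost1 (mev c X Z) g :=
    Multicategory.InternalHoms.sub2_lam (c := c) _
  refine (congrArg C.curry2 h).trans ?_
  exact C.curry2_post1 (mev c X Z) g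

theorem element_one (X : C.carrier) :
    C.element (mone c X) ≫ comparison c X X = C.j X := by
  have h : C.msub2 (C.mid X) (mone c X) (mev c X X) = C.mid X :=
    Multicategory.InternalHoms.sub2_lam (c := c) _
  have h2 := (C.element_sub2_unary_nullary (C.mid X) (mone c X) (mev c X X)).symm.trans
    (congrArg C.element h)
  rw [← γ_ofUnary, ofUnary_id, C.γ_id, C.pre_id, Category.comp_id] at h2
  exact h2

/-- The structure of ⟨–, –⟩ is defined by (1, L) · ev = μ and (1, μ) · ev = (ev, 1) · ev. Currying
the second produces L of C, because the component of the binary morphism ev contains it; the first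
replaces the curried μ by L of the multicategory followed by a comparison. -/
theorem comparison_L (X Y Z : C.carrier) :
    C.ofUnary (mL c X Y Z) ≫
        comparison c (mH c X Y) (mH c X Z) ≫ C.post (mH c X Y) (comparison c X Z) =
      comparison c Y Z ≫ C.L X Y Z ≫ C.pre (comparison c X Y) (C.H X Z) := by
  have h1 : C.msub2 (C.mid (mH c X Y)) (mL c X Y Z) (mev c (mH c X Y) (mH c X Z)) =
      mmu c X Y Z :=
    Multicategory.InternalHoms.sub2_lam (c := c) _
  have h2 : C.msub2 (C.mid X) (mmu c X Y Z) (mev c X Z) =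
      C.msub2 (mev c X Y) (C.mid (mH c Y Z)) (mev c Y Z) :=
    Multicategory.InternalHoms.sub2_lam (c := c) _
  have h3 := C.element_sub2_unary_binary (C.mid X) (mmu c X Y Z) (mev c X Z)
  have h4 := C.element_sub2_binary_unary (mev c X Y) (C.mid (mH c Y Z)) (mev c Y Z)
  have h5 := C.γ_injective (h3.symm.trans ((congrArg C.element h2).trans h4))
  have h6 := (curry2_id_ev c (mL c X Y Z)).symm.trans (congrArg C.curry2 h1)
  rw [ofUnary_id, ofUnary_id, C.pre_id, Category.comp_id, Category.id_comp, ← h6,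
    component_binary, Category.assoc] at h5
  exact h5

theorem ofUnary_undU {I : C.carrier} (u : C.MHom [] I) (X : C.carrier) :
    C.ofUnary (mundU c u X) = comparison c I X ≫ C.component u X := by
  have h := C.ofUnary_sub2_nullary_unary u (C.mid (mH c I X)) (mev c I X)
  rw [ofUnary_id, Category.id_comp] at h
  exact h

end ClosedCategory

/-! ### Units and the closed functor to C. -/

namespace ClosedCategory

variable {C : ClosedCategory.{v, u}}

/-- The unary morphism of the multicategory corresponding to a morphism of `C`. -/
noncomputable def toUnary {X Y : C.carrier} (f : X ⟶ Y) : C.MHom [X] Y :=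
  ((C.ofUnary_bijective X Y).2 f).choose

theorem ofUnary_toUnary {X Y : C.carrier} (f : X ⟶ Y) : C.ofUnary (toUnary f) = f :=
  ((C.ofUnary_bijective X Y).2 f).choose_spec

theorem ofUnary_injective {X Y : C.carrier} {f g : C.MHom [X] Y}
    (h : C.ofUnary f = C.ofUnary g) : f = g :=
  (C.ofUnary_bijective X Y).1 h

/-- The functor from the underlying category of the multicategory associated with `C`
to `C`, which is the identity on objects. -/
noncomputable def forget (C : ClosedCategory.{v, u}) : C.multicategory.Obj ⥤ C.carrier where
  obj X := X
  map {X Y} f := C.ofUnary (A := X) (Z := Y) f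
  map_id X := C.ofUnary_id X
  map_comp f g := C.ofUnary_post1 f g

/-- The inverse of the functor `forget`. -/
noncomputable def forgetInv (C : ClosedCategory.{v, u}) : C.carrier ⥤ C.multicategory.Obj where
  obj X := X
  map {X Y} f := toUnary f
  map_id X := by
    apply ofUnary_injective
    rw [ofUnary_toUnary]
    exact (C.ofUnary_id X).symm
  map_comp {X Y Z} f g := by
    apply ofUnary_injective
    rw [ofUnary_toUnary]
    refine Eq.symm ((C.ofUnary_post1 (toUnary f) (toUnary g)).trans ?_)
    rw [ofUnary_toUnary, ofUnary_toUnary]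

theorem isIso_of_ofUnary {X Y : C.multicategory.Obj} (f : X ⟶ Y)
    (h : IsIso (C.ofUnary (A := X) (Z := Y) f)) : IsIso f := by
  obtain ⟨g, h1, h2⟩ := h.out
  refine ⟨toUnary g, ofUnary_injective ?_, ofUnary_injective ?_⟩
  · refine (C.ofUnary_post1 (A := X) (B := Y) (Z := X) f (toUnary g)).trans ?_
    exact (congrArg (fun t => C.ofUnary f ≫ t) (ofUnary_toUnary g)).trans
      (h1.trans (C.ofUnary_id X).symm)
  · refine (C.ofUnary_post1 (A := Y) (B := X) (Z := Y) (toUnary g) f).trans ?_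
    exact (congrArg (fun t => t ≫ C.ofUnary f) (ofUnary_toUnary g)).trans
      (h2.trans (C.ofUnary_id Y).symm)

/-- The element `1 → I` corresponding to a nullary morphism `() → I`. -/
def ofNullary {I : C.carrier} (u : C.MHom [] I) : C.unit ⟶ I := C.element u

/-- The component `[I, X] → X` of a nullary morphism `() → I`. -/
def nullaryComponent {I : C.carrier} (u : C.MHom [] I) (X : C.carrier) : C.H I X ⟶ X :=
  C.component u X

theorem nullaryComponent_i {I : C.carrier} (u : C.MHom [] I) (X : C.carrier) :
    nullaryComponent u X ≫ C.i.hom.app X = C.pre (ofNullary u) X :=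
  C.component_nullary_i u X

theorem isIso_i (X : C.carrier) : IsIso (C.i.hom.app X) := inferInstance

theorem isIso_nullaryComponent_iff {I : C.carrier} (u : C.MHom [] I) (X : C.carrier) :
    IsIso (nullaryComponent u X) ↔ IsIso (C.pre (ofNullary u) X) := by
  have := isIso_i X
  rw [← nullaryComponent_i]
  exact (isIso_comp_right_iff (nullaryComponent u X) (C.i.hom.app X)).symm

variable (c : C.multicategory.InternalHoms)

theorem ofUnary_mundU {I : C.carrier} (u : C.MHom [] I) (X : C.carrier) :
    C.ofUnary (mundU c u X) = comparison c I X ≫ nullaryComponent u X :=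
  ofUnary_undU c u X

/-- The morphism [u, 1] is the comparison followed by a component which, after i, becomes [t, 1] for
the element t of u; the comparison and i are invertible. -/
theorem isIso_mundU_iff {I : C.carrier} (u : C.MHom [] I) (X : C.carrier) :
    IsIso (C.ofUnary (mundU c u X)) ↔ IsIso (C.pre (ofNullary u) X) := by
  have := isIso_comparison c I X
  rw [ofUnary_mundU, isIso_comp_left_iff, isIso_nullaryComponent_iff]

theorem exists_isUnit :
    ∃ u : C.multicategory.Hom [] C.unit, c.IsUnit C.unit u := by
  -- The Yoneda image of the identity 1 → 1.
  let u : C.MHom [] C.unit :=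
    VFunctor.ofElt (K := C.unit) (G := VFunctor.id C.und) (𝟙 C.unit)
  have hu : ofNullary u = 𝟙 C.unit :=
    VFunctor.elt_ofElt (K := C.unit) (G := VFunctor.id C.und) (𝟙 C.unit)
  refine ⟨u, fun X => isIso_of_ofUnary _ ((isIso_mundU_iff c u X).2 ?_)⟩
  rw [hu]
  exact C.isIso_pre (𝟙 C.unit) X

variable {I : C.carrier} {u : C.MHom [] I}

/-- The unit condition makes [t, 1] invertible at every object for the element t of u, and such a t
is itself invertible. It provides the inverse of the unit constraint. -/
theorem isIso_ofNullary (hu : c.IsUnit I u) : IsIso (ofNullary u) := by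
  apply C.isIso_of_isIso_pre
  intro X
  rw [← isIso_mundU_iff c]
  have := hu X
  exact Functor.map_isIso (forget C) (c.undU u X)

/-- The morphism `j_X` of the underlying closed category. -/
noncomputable def mj (hu : c.IsUnit I u) (X : C.carrier) : C.MHom [I] (mH c X X) := hu.j X

/-- The morphism `i_X` of the underlying closed category. -/
noncomputable def mi (hu : c.IsUnit I u) (X : C.carrier) : C.MHom [X] (mH c I X) :=
  hu.i.hom.app X

/-- Composing with u reduces j to the nullary morphism naming the identity, whose element the
comparison carries to j of C. -/
theorem comparison_j (hu : c.IsUnit I u) (X : C.carrier) :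
    ofNullary u ≫ C.ofUnary (mj c hu X) ≫ comparison c X X = C.j X := by
  have h : C.mpost1 u (mj c hu X) = mone c X := hu.post1_bar (c.one X)
  have h2 : ofNullary u ≫ C.ofUnary (mj c hu X) = C.element (mone c X) :=
    (C.element_post1_nullary u (mj c hu X)).symm.trans (congrArg C.element h)
  rw [← Category.assoc, h2]
  exact element_one c X

/-- Follows from i being inverse to [u, 1], once [u, 1] is written through the comparison and the
element of u. -/
theorem comparison_i (hu : c.IsUnit I u) (X : C.carrier) :
    C.ofUnary (mi c hu X) ≫ comparison c I X ≫ C.pre (ofNullary u) X = C.i.hom.app X := by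
  have h : C.mpost1 (mi c hu X) (mundU c u X) = C.mid X := hu.i_undU X
  have h2 := (C.ofUnary_post1 (mi c hu X) (mundU c u X)).symm.trans (congrArg C.ofUnary h)
  rw [ofUnary_mundU, ofUnary_id] at h2
  rw [← nullaryComponent_i, reassoc_of% h2]

/-- The closed functor from the underlying closed category of the multicategory associated
with `C` to `C`. -/
noncomputable def forgetClosed (hu : c.IsUnit I u) : ClosedFunctor (c.underlying hu) C where
  φ := forget C
  φhat X Y := comparison c X Y
  φ0 := ofNullary u
  φhat_natural_left {X X'} f Y := comparison_pre c (X := X) (X' := X') f Y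
  φhat_natural_right X {Y Y'} g := comparison_post c X (Z := Y) (Z' := Y') g
  CF1 X := comparison_j c hu X
  CF2 X := comparison_i c hu X
  CF3 X Y Z := comparison_L c X Y Z

/-! ### The inverse closed functor and the isomorphism. -/

/-- The inverse of `comparison`. -/
noncomputable def comparisonInv (X Z : C.carrier) : C.H X Z ⟶ mH c X Z :=
  haveI := isIso_comparison c X Z
  inv (comparison c X Z)

theorem comparison_comparisonInv (X Z : C.carrier) :
    comparison c X Z ≫ comparisonInv c X Z = 𝟙 _ :=
  haveI := isIso_comparison c X Z
  IsIso.hom_inv_id (comparison c X Z)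

theorem comparisonInv_comparison (X Z : C.carrier) :
    comparisonInv c X Z ≫ comparison c X Z = 𝟙 _ :=
  haveI := isIso_comparison c X Z
  IsIso.inv_hom_id (comparison c X Z)

theorem comparisonInv_pre {X X' : C.carrier} (f : C.MHom [X] X') (Z : C.carrier) :
    comparisonInv c X' Z ≫ C.ofUnary (mpre c f Z) =
      C.pre (C.ofUnary f) Z ≫ comparisonInv c X Z := by
  have h := congrArg (fun t => comparisonInv c X' Z ≫ t ≫ comparisonInv c X Z)
    (comparison_pre c f Z)
  simp only [Category.assoc] at h
  rwa [comparison_comparisonInv, Category.comp_id,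
    reassoc_of% (comparisonInv_comparison c X' Z)] at h

theorem comparisonInv_post (X : C.carrier) {Z Z' : C.carrier} (g : C.MHom [Z] Z') :
    comparisonInv c X Z ≫ C.ofUnary (mpost c X g) =
      C.post X (C.ofUnary g) ≫ comparisonInv c X Z' := by
  have h := congrArg (fun t => comparisonInv c X Z ≫ t ≫ comparisonInv c X Z')
    (comparison_post c X g)
  simp only [Category.assoc] at h
  rwa [comparison_comparisonInv, Category.comp_id,
    reassoc_of% (comparisonInv_comparison c X Z)] at h

/-- Obtained by inverting `comparison_L`. The inverse functor needs the outer internal Hom at [X, Y]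
and [X, Z] rather than at ⟨X, Y⟩ and ⟨X, Z⟩, so naturality of the inverse comparison in both
variables is also used. -/
theorem comparisonInv_L (X Y Z : C.carrier) :
    C.L X Y Z ≫ comparisonInv c (C.H X Y) (C.H X Z) ≫
        C.ofUnary (mpost c (C.H X Y) (toUnary (comparisonInv c X Z))) =
      comparisonInv c Y Z ≫ C.ofUnary (mL c X Y Z) ≫
        C.ofUnary (mpre c (toUnary (comparisonInv c X Y)) (mH c X Z)) := by
  have h1 : C.post (mH c X Y) (comparison c X Z) ≫ C.post (mH c X Y) (comparisonInv c X Z) =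
      𝟙 _ := by
    rw [← C.post_comp, comparison_comparisonInv, C.post_id]
  have h2 : C.pre (comparison c X Y) (mH c X Z) ≫ C.pre (comparisonInv c X Y) (mH c X Z) =
      𝟙 _ := by
    rw [← C.pre_comp, comparisonInv_comparison, C.pre_id]
  -- `comparison_L` solved for L of the multicategory.
  have h3 : comparisonInv c Y Z ≫ C.ofUnary (mL c X Y Z) =
      C.L X Y Z ≫ C.post (C.H X Y) (comparisonInv c X Z) ≫
        C.pre (comparison c X Y) (mH c X Z) ≫ comparisonInv c (mH c X Y) (mH c X Z) := by
    have h := congrArg (fun t => comparisonInv c Y Z ≫ t ≫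
      C.post (mH c X Y) (comparisonInv c X Z) ≫ comparisonInv c (mH c X Y) (mH c X Z))
      (comparison_L c X Y Z)
    simp only [Category.assoc] at h
    rw [reassoc_of% h1, comparison_comparisonInv, Category.comp_id,
      reassoc_of% (comparisonInv_comparison c Y Z), reassoc_of% C.pre_post] at h
    exact h
  rw [comparisonInv_post, ofUnary_toUnary, ← Category.assoc (comparisonInv c Y Z), h3]
  simp only [Category.assoc]
  rw [comparisonInv_pre, ofUnary_toUnary, reassoc_of% h2]

/-- The inverse of the element `1 → I` corresponding to a unit `() → I`. -/
noncomputable def ofNullaryInv (hu : c.IsUnit I u) : I ⟶ C.unit :=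
  haveI := isIso_ofNullary c hu
  inv (ofNullary u)

theorem ofNullary_ofNullaryInv (hu : c.IsUnit I u) :
    ofNullary u ≫ ofNullaryInv c hu = 𝟙 _ :=
  haveI := isIso_ofNullary c hu
  IsIso.hom_inv_id (ofNullary u)

theorem ofNullaryInv_ofNullary (hu : c.IsUnit I u) :
    ofNullaryInv c hu ≫ ofNullary u = 𝟙 _ :=
  haveI := isIso_ofNullary c hu
  IsIso.inv_hom_id (ofNullary u)

theorem comparisonInv_j (hu : c.IsUnit I u) (X : C.carrier) :
    ofNullaryInv c hu ≫ C.j X ≫ comparisonInv c X X = C.ofUnary (mj c hu X) := by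
  rw [← comparison_j c hu X]
  simp only [Category.assoc]
  rw [reassoc_of% (ofNullaryInv_ofNullary c hu), comparison_comparisonInv, Category.comp_id]

theorem comparisonInv_i (hu : c.IsUnit I u) (X : C.carrier) :
    C.i.hom.app X ≫ comparisonInv c C.unit X ≫
      C.ofUnary (mpre c (toUnary (ofNullaryInv c hu)) X) = C.ofUnary (mi c hu X) := by
  have h : C.pre (ofNullary u) X ≫ C.pre (ofNullaryInv c hu) X = 𝟙 _ := by
    rw [← C.pre_comp, ofNullaryInv_ofNullary, C.pre_id]
  rw [comparisonInv_pre, ofUnary_toUnary, ← comparison_i c hu X]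
  simp only [Category.assoc]
  rw [reassoc_of% h, comparison_comparisonInv, Category.comp_id]

theorem mpost1_toUnary {X Y Z : C.carrier} (f : X ⟶ Y) (g : Y ⟶ Z) :
    C.mpost1 (toUnary f) (toUnary g) = toUnary (f ≫ g) := by
  apply ofUnary_injective
  rw [ofUnary_post1, ofUnary_toUnary, ofUnary_toUnary, ofUnary_toUnary]

/-- The closed functor inverse to `forgetClosed`. -/
noncomputable def forgetClosedInv (hu : c.IsUnit I u) : ClosedFunctor C (c.underlying hu) where
  φ := forgetInv C
  φhat X Y := toUnary (comparisonInv c X Y)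
  φ0 := toUnary (ofNullaryInv c hu)
  φhat_natural_left {X X'} f Y := by
    change C.mpost1 (toUnary (C.pre f Y)) (toUnary (comparisonInv c X Y)) =
      C.mpost1 (toUnary (comparisonInv c X' Y)) (mpre c (toUnary f) Y)
    apply ofUnary_injective
    rw [ofUnary_post1, ofUnary_post1, ofUnary_toUnary, ofUnary_toUnary, ofUnary_toUnary,
      comparisonInv_pre, ofUnary_toUnary]
  φhat_natural_right X {Y Y'} g := by
    change C.mpost1 (toUnary (C.post X g)) (toUnary (comparisonInv c X Y')) =
      C.mpost1 (toUnary (comparisonInv c X Y)) (mpost c X (toUnary g))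
    apply ofUnary_injective
    rw [ofUnary_post1, ofUnary_post1, ofUnary_toUnary, ofUnary_toUnary, ofUnary_toUnary,
      comparisonInv_post, ofUnary_toUnary]
  CF1 X := by
    change C.mpost1 (toUnary (ofNullaryInv c hu)) (C.mpost1 (toUnary (C.j X))
      (toUnary (comparisonInv c X X))) = mj c hu X
    apply ofUnary_injective
    rw [mpost1_toUnary, mpost1_toUnary, ofUnary_toUnary, comparisonInv_j]
  CF2 X := by
    change C.mpost1 (toUnary (C.i.hom.app X)) (C.mpost1 (toUnary (comparisonInv c C.unit X))
      (mpre c (toUnary (ofNullaryInv c hu)) X)) = mi c hu X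
    apply ofUnary_injective
    rw [ofUnary_post1, ofUnary_post1, ofUnary_toUnary, ofUnary_toUnary]
    exact comparisonInv_i c hu X
  CF3 X Y Z := by
    change C.mpost1 (toUnary (C.L X Y Z)) (C.mpost1
        (toUnary (comparisonInv c (C.H X Y) (C.H X Z)))
        (mpost c (C.H X Y) (toUnary (comparisonInv c X Z)))) =
      C.mpost1 (toUnary (comparisonInv c Y Z)) (C.mpost1 (mL c X Y Z)
        (mpre c (toUnary (comparisonInv c X Y)) (mH c X Z)))
    apply ofUnary_injective
    rw [ofUnary_post1, ofUnary_post1, ofUnary_post1, ofUnary_post1, ofUnary_toUnary,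
      ofUnary_toUnary, ofUnary_toUnary, comparisonInv_L]

theorem _root_.ClosedFunctor.eq_id {D : ClosedCategory.{v₁, u₁}} (Φ : ClosedFunctor D D)
    (h : Φ.φ = 𝟭 D.carrier) (h1 : ∀ X Y, HEq (Φ.φhat X Y) (𝟙 (D.H X Y)))
    (h0 : HEq Φ.φ0 (𝟙 D.unit)) : Φ = ClosedFunctor.id D := by
  obtain ⟨φ, φhat, φ0, _, _, _, _, _⟩ := Φ
  -- Once φ is replaced by the identity, the types on the two sides of the heterogeneous equalities
  -- agree; the remaining fields are propositions.
  dsimp only at h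
  subst h
  have e1 : φhat = fun X Y => 𝟙 (D.H X Y) :=
    funext fun X => funext fun Y => eq_of_heq (h1 X Y)
  have e0 : φ0 = 𝟙 D.unit := eq_of_heq h0
  subst e1
  subst e0
  rfl

/-- The underlying closed category of the multicategory associated with `C` is isomorphic
to `C`. -/
noncomputable def underlyingIso (hu : c.IsUnit I u) :
    ClosedCategory.Iso (c.underlying hu) C where
  hom := forgetClosed c hu
  inv := forgetClosedInv c hu
  hom_inv_id := by
    apply ClosedFunctor.eq_id
    -- Both functors are the identity on objects, and `toUnary` is inverse to `ofUnary`.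
    · exact Functor.hext (fun _ => rfl)
        (fun _ _ _ => heq_of_eq (ofUnary_injective (ofUnary_toUnary _)))
    · intro X Y
      apply heq_of_eq
      change C.mpost1 (toUnary (comparison c X Y)) (toUnary (comparisonInv c X Y)) =
        C.mid (mH c X Y)
      apply ofUnary_injective
      rw [mpost1_toUnary, ofUnary_toUnary]
      exact (comparison_comparisonInv c X Y).trans (C.ofUnary_id (mH c X Y)).symm
    · apply heq_of_eq
      change C.mpost1 (toUnary (ofNullaryInv c hu)) (toUnary (ofNullary u)) = C.mid I
      apply ofUnary_injective
      rw [mpost1_toUnary, ofUnary_toUnary, ofNullaryInv_ofNullary, ofUnary_id]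
  inv_hom_id := by
    apply ClosedFunctor.eq_id
    · exact Functor.hext (fun _ => rfl) (fun _ _ f => heq_of_eq (ofUnary_toUnary f))
    · intro X Y
      apply heq_of_eq
      change C.ofUnary (toUnary (comparisonInv c X Y)) ≫ comparison c X Y = 𝟙 (C.H X Y)
      rw [ofUnary_toUnary, comparisonInv_comparison]
    · apply heq_of_eq
      change ofNullary u ≫ C.ofUnary (toUnary (ofNullaryInv c hu)) = 𝟙 C.unit
      rw [ofUnary_toUnary, ofNullary_ofNullaryInv]

end ClosedCategory

/-- The Eilenberg–Kelly axioms CC0 and CC5' enter only through `toClosedCategory`, where they yield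
the bijectivity of γ. -/
theorem mainTheorem2 (V : EKClosedCategory.{v, u}) :
    V.toClosedCategory.multicategory.IsClosed ∧
    ∀ c : V.toClosedCategory.multicategory.InternalHoms,
      (∃ u : V.toClosedCategory.multicategory.Hom [] V.unit, c.IsUnit V.unit u) ∧
      ∀ (I : V.toClosedCategory.multicategory.Obj)
        (u : V.toClosedCategory.multicategory.Hom [] I) (hu : c.IsUnit I u),
        Nonempty (ClosedCategory.Iso (c.underlying hu) V.toClosedCategory) :=
  ⟨V.toClosedCategory.multicategory_isClosed, fun c =>
    ⟨ClosedCategory.exists_isUnit c, fun _ _ hu => ⟨ClosedCategory.underlyingIso c hu⟩⟩⟩
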